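/- Let $q_n(t),r_n(t)$ ($n\in\mathbb Z$, $t\in\mathbb R$) be complex-valued functions that solve the coupled semi-discrete mKdV system $$\partial_tQ_n=(1-Q_nR_n)(Q_{n+1}-Q_{n-1}),\qquad \partial_tR_n=(1-Q_nR_n)(R_{n+1}-R_{n-1}) \tag{1}$$ (with $Q=q$, $R=r$). Put $\alpha_n=1-q_nr_n$, assume $\alpha_n(t)\neq0$ for all $n,t$, and let $\alpha_n^{1/2}$ denote a fixed choice of square roots of $\alpha_n$. Let $m\ge 0$ be an integer, $A\in\mathbb C^{(2m+2)\times(2m+2)}$ with $|A|\ne0$, $I$ the identity matrix, and let the column vectors $\Phi_n(t),\Psi_n(t)\in\mathbb C^{2m+2}$ satisfy, for all $n\in\mathbb Z$ and $t\in\mathbb R$, $$\begin{bmatrix}\Phi_{n+1}\\ \Psi_{n+1}\end{bmatrix}=\alpha_n^{-1/2}\begin{bmatrix}A&q_nI\\ r_nI&A^{-1}\end{bmatrix}\begin{bmatrix}\Phi_n\\ \Psi_n\end{bmatrix},\qquad 2\partial_t\begin{bmatrix}\Phi_n\\ \Psi_n\end{bmatrix}=\begin{bmatrix}A^2-A^{-2}+\gamma_nI&2q_nA+2q_{n-1}A^{-1}\\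 2r_{n-1}A+2r_nA^{-1}&A^{-2}-A^2-\gamma_nI\end{bmatrix}\begin{bmatrix}\Phi_n\\ \Psi_n\end{bmatrix},\tag{2}$$ where $\gamma_n=r_nq_{n-1}-q_nr_{n-1}$. Define the quasi double Casoratians $$F_n=F(A,\Phi_n,\Psi_n)=\alpha_n^{(m+1)/2}\,|\Phi_{n+1},A^2\Phi_{n+1},\dots,A^{2m}\Phi_{n+1};\,\Psi_n,A^2\Psi_n,\dots,A^{2m}\Psi_n|,$$ $$G_n=G(A,\Phi_n,\Psi_n)=\alpha_n^{(m+1)/2}\,|\Phi_n,A\Phi_{n+1},A^3\Phi_{n+1},\dots,A^{2m+1}\Phi_{n+1};\,A\Psi_n,A^3\Psi_n,\dots,A^{2m-1}\Psi_n|,$$ $$H_n=H(A,\Phi_n,\Psi_n)=\alpha_n^{(m+1)/2}\,|A\Phi_{n+1},A^3\Phi_{n+1},\dots,A^{2m-1}\Phi_{n+1};\,\Psi_{n+1},A\Psi_n,A^3\Psi_n,\dots,A^{2m+1}\Psi_n|,$$ where $\alpha_n^{(m+1)/2}=(\alpha_n^{1/2})^{m+1}$. Write $D_tG\cdot F=(\partial_t-\partial_{t'})G(t)F(t')|_{t'=t}$.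 Then: 1. For all $n\in\mathbb Z$ and $t\in\mathbb R$, the functions $F_n,G_n,H_n$ are differentiable in $t$ and satisfy $$\alpha_nF_{n+1}F_{n-1}+G_nH_n-F_n^2=0,$$ $$D_tG_n\cdot F_n=\alpha_n(G_{n+1}F_{n-1}-G_{n-1}F_{n+1}),$$ $$D_tH_n\cdot F_n=\alpha_n(H_{n+1}F_{n-1}-H_{n-1}F_{n+1}).$$ 2. $Q_n=G_n/F_n$ and $R_n=H_n/F_n$ satisfy (1) at every $(n,t)$ at which $F_{n-1},F_n,F_{n+1}$ are nonzero. 3. If $P,J\in\mathbb C^{(2m+2)\times(2m+2)}$ with $|P|\neq0$ and $A=P^{-1}JP$, then $J$ is invertible, the vectors $\Phi'_n=P\Phi_n$, $\Psi'_n=P\Psi_n$ satisfy (2) with $J$ in place of $A$, $F(J,\Phi'_n,\Psi'_n)$ vanishes at exactly the same points as $F(A,\Phi_n,\Psi_n)$, and $(J,\Phi'_n,\Psi'_n)$ gives the same $Q_n$ and $R_n$ as $(A,\Phi_n,\Psi_n)$. -/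

import Mathlib

open scoped Matrix

/-- At the lattice site `n` and the time `t`, the pair `(Q, R)` satisfies the coupled
semi-discrete mKdV system
`∂ₜ Qₙ = (1 - Qₙ Rₙ) (Qₙ₊₁ - Qₙ₋₁)`, `∂ₜ Rₙ = (1 - Qₙ Rₙ) (Rₙ₊₁ - Rₙ₋₁)`
(the derivatives exist and have these values). -/
def SolvesCoupledAt (Q R : ℤ → ℝ → ℂ) (n : ℤ) (t : ℝ) : Prop :=
  HasDerivAt (Q n) ((1 - Q n t * R n t) * (Q (n + 1) t - Q (n - 1) t)) t ∧
  HasDerivAt (R n) ((1 - Q n t * R n t) * (R (n + 1) t - R (n - 1) t)) t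

/-- The Hirota derivative
`Dₜ G · F = (∂ₜ - ∂ₜ') G(t) F(t')` evaluated at `t' = t`. -/
noncomputable def hirotaD (G F : ℝ → ℂ) (t : ℝ) : ℂ :=
  deriv (fun τ => G τ * F t) t - deriv (fun τ => G t * F τ) t

/-- At `(n, t)`, the functions `F, G, H` are differentiable in time and satisfy the bilinear
system with background `(q, r)`. -/
def SolvesBilinearAt (q r F G H : ℤ → ℝ → ℂ) (n : ℤ) (t : ℝ) : Prop :=
  (DifferentiableAt ℝ (F n) t ∧ DifferentiableAt ℝ (G n) t ∧ DifferentiableAt ℝ (H n) t) ∧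
  (1 - q n t * r n t) * F (n + 1) t * F (n - 1) t + G n t * H n t - F n t ^ 2 = 0 ∧
  hirotaD (G n) (F n) t =
    (1 - q n t * r n t) * (G (n + 1) t * F (n - 1) t - G (n - 1) t * F (n + 1) t) ∧
  hirotaD (H n) (F n) t =
    (1 - q n t * r n t) * (H (n + 1) t * F (n - 1) t - H (n - 1) t * F (n + 1) t)

section Lax

variable {ι : Type*} [Fintype ι] [DecidableEq ι]

/-- The spectral matrix `Mₙ = αₙ^{-1/2} [[A, qₙ I], [rₙ I, A⁻¹]]` at time `t`; the function `s`
is the chosen square root `αₙ^{1/2}` of `αₙ = 1 - qₙ rₙ`. -/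
noncomputable def laxM (q r s : ℤ → ℝ → ℂ) (A : Matrix ι ι ℂ) (n : ℤ) (t : ℝ) :
    Matrix (ι ⊕ ι) (ι ⊕ ι) ℂ :=
  (s n t)⁻¹ • Matrix.fromBlocks A (q n t • (1 : Matrix ι ι ℂ)) (r n t • (1 : Matrix ι ι ℂ)) A⁻¹

/-- The time-evolution matrix `Nₙ` at time `t`. -/
noncomputable def laxN (q r : ℤ → ℝ → ℂ) (A : Matrix ι ι ℂ) (n : ℤ) (t : ℝ) :
    Matrix (ι ⊕ ι) (ι ⊕ ι) ℂ :=
  Matrix.fromBlocks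
    (A ^ 2 - A⁻¹ ^ 2 + (r n t * q (n - 1) t - q n t * r (n - 1) t) • (1 : Matrix ι ι ℂ))
    ((2 * q n t) • A + (2 * q (n - 1) t) • A⁻¹)
    ((2 * r (n - 1) t) • A + (2 * r n t) • A⁻¹)
    (A⁻¹ ^ 2 - A ^ 2 - (r n t * q (n - 1) t - q n t * r (n - 1) t) • (1 : Matrix ι ι ℂ))

/-- The vector functions `Φₙ(t), Ψₙ(t)` satisfy the matrix spectral and time-evolution equations
`[Φₙ₊₁; Ψₙ₊₁] = Mₙ [Φₙ; Ψₙ]` and `2 ∂ₜ [Φₙ; Ψₙ] = Nₙ [Φₙ; Ψₙ]`, for all `n` and `t`. -/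
def SolvesLax (q r s : ℤ → ℝ → ℂ) (A : Matrix ι ι ℂ) (Φ Ψ : ℤ → ℝ → ι → ℂ) : Prop :=
  ∀ (n : ℤ) (t : ℝ),
    Sum.elim (Φ (n + 1) t) (Ψ (n + 1) t) = laxM q r s A n t *ᵥ Sum.elim (Φ n t) (Ψ n t) ∧
    HasDerivAt (fun τ => Sum.elim (Φ n τ) (Ψ n τ))
      ((2 : ℂ)⁻¹ • (laxN q r A n t *ᵥ Sum.elim (Φ n t) (Ψ n t))) t

end Lax

/-- The determinant `|v₀, v₁, …|` whose `j`-th column is the vector `v j`. -/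
noncomputable def colDet {N : ℕ} (v : Fin N → Fin N → ℂ) : ℂ :=
  (Matrix.of fun i j => v j i).det

/-- `F(A, Φₙ, Ψₙ) = αₙ^{(m+1)/2}
|Φₙ₊₁, A² Φₙ₊₁, …, A^{2m} Φₙ₊₁; Ψₙ, A² Ψₙ, …, A^{2m} Ψₙ|`. -/
noncomputable def casoratianF (m : ℕ) (s : ℤ → ℝ → ℂ)
    (A : Matrix (Fin (2 * m + 2)) (Fin (2 * m + 2)) ℂ)
    (Φ Ψ : ℤ → ℝ → Fin (2 * m + 2) → ℂ) (n : ℤ) (t : ℝ) : ℂ :=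
  s n t ^ (m + 1) * colDet fun j : Fin (2 * m + 2) =>
    if (j : ℕ) < m + 1 then A ^ (2 * (j : ℕ)) *ᵥ Φ (n + 1) t
    else A ^ (2 * ((j : ℕ) - (m + 1))) *ᵥ Ψ n t

/-- `G(A, Φₙ, Ψₙ) = αₙ^{(m+1)/2}
|Φₙ, A Φₙ₊₁, A³ Φₙ₊₁, …, A^{2m+1} Φₙ₊₁; A Ψₙ, A³ Ψₙ, …, A^{2m-1} Ψₙ|`. -/
noncomputable def casoratianG (m : ℕ) (s : ℤ → ℝ → ℂ)
    (A : Matrix (Fin (2 * m + 2)) (Fin (2 * m + 2)) ℂ)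
    (Φ Ψ : ℤ → ℝ → Fin (2 * m + 2) → ℂ) (n : ℤ) (t : ℝ) : ℂ :=
  s n t ^ (m + 1) * colDet fun j : Fin (2 * m + 2) =>
    if (j : ℕ) = 0 then Φ n t
    else if (j : ℕ) < m + 2 then A ^ (2 * ((j : ℕ) - 1) + 1) *ᵥ Φ (n + 1) t
    else A ^ (2 * ((j : ℕ) - (m + 2)) + 1) *ᵥ Ψ n t

/-- `H(A, Φₙ, Ψₙ) = αₙ^{(m+1)/2}
|A Φₙ₊₁, A³ Φₙ₊₁, …, A^{2m-1} Φₙ₊₁; Ψₙ₊₁, A Ψₙ, A³ Ψₙ, …, A^{2m+1} Ψₙ|`. -/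
noncomputable def casoratianH (m : ℕ) (s : ℤ → ℝ → ℂ)
    (A : Matrix (Fin (2 * m + 2)) (Fin (2 * m + 2)) ℂ)
    (Φ Ψ : ℤ → ℝ → Fin (2 * m + 2) → ℂ) (n : ℤ) (t : ℝ) : ℂ :=
  s n t ^ (m + 1) * colDet fun j : Fin (2 * m + 2) =>
    if (j : ℕ) < m then A ^ (2 * (j : ℕ) + 1) *ᵥ Φ (n + 1) t
    else if (j : ℕ) = m then Ψ (n + 1) t
    else A ^ (2 * ((j : ℕ) - (m + 1)) + 1) *ᵥ Ψ n t

/-- `Qₙ = Gₙ / Fₙ`. -/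
noncomputable def casoratianQ (m : ℕ) (s : ℤ → ℝ → ℂ)
    (A : Matrix (Fin (2 * m + 2)) (Fin (2 * m + 2)) ℂ)
    (Φ Ψ : ℤ → ℝ → Fin (2 * m + 2) → ℂ) (n : ℤ) (t : ℝ) : ℂ :=
  casoratianG m s A Φ Ψ n t / casoratianF m s A Φ Ψ n t

/-- `Rₙ = Hₙ / Fₙ`. -/
noncomputable def casoratianR (m : ℕ) (s : ℤ → ℝ → ℂ)
    (A : Matrix (Fin (2 * m + 2)) (Fin (2 * m + 2)) ℂ)
    (Φ Ψ : ℤ → ℝ → Fin (2 * m + 2) → ℂ) (n : ℤ) (t : ℝ) : ℂ :=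
  casoratianH m s A Φ Ψ n t / casoratianF m s A Φ Ψ n t

/-!
Write `xₖ = Aᵏ Φₙ` and `yₖ = Aᵏ Ψₙ` for `k ∈ ℤ` (`orbit`). The spectral equation turns the quasi
double Casoratians into determinants in the vectors of a single site: by column operations
(`colDet_column_operations`),
`Fₙ = |x₁, x₃, …, x₂ₘ₊₁; y₀, y₂, …, y₂ₘ|` (`casoratian`), and all of `Fₙ`, `Gₙ`, `Hₙ`, `Fₙ₊₁`,
`Gₙ₊₁`, `Fₙ₋₁`, `Gₙ₋₁` become, up to powers of `det A`, the sign `(-1)ᵐ` and the factor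
`αₙ = 1 - qₙ rₙ`, values of the one alternating form
`[u, v] = |u, x₂, x₄, …, x₂ₘ; v, y₁, y₃, …, y₂ₘ₋₁|` (`bracket`). With
`a = x₂ₘ₊₂ + qₙ y₂ₘ₊₁` and `b = y₋₁ + rₙ x₀`,
`Gₙ = [x₀, a]`, `Hₙ = [b, y₂ₘ₊₁]`, `Fₙ = det A [x₀, b] = (det A)⁻¹ [a, y₂ₘ₊₁]`,
`Fₙ₋₁ = (-1)ᵐ [x₀, y₂ₘ₊₁]`, `αₙ Fₙ₊₁ = (-1)ᵐ [a, b]`,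
so the first bilinear equation is the three-term Plücker relation (`colDet_plucker`).

For the evolution equations, the parts `± ½ (A² - A⁻²)` of the time evolution shift the columns, and
in the derivative of a determinant all but the extreme columns drop out. To make the two signs
agree, `½ (A² - A⁻²)` times each column is added to its derivative, which changes the derivative of
the determinant by a trace times the determinant (`sum_colDet_update_mulVec`); this trace term is the same for `F` and `G` and cancels in
`Dₜ G · F`. What remains (`LaxFlow.hasDerivAt_casoratian`, `LaxFlow.hasDerivAt_bracket`) is again
written in brackets, and the equation for `G` is the combination of two Plücker relations
(`exists_hasDerivAt_casoratian`). The Lax pair is invariant under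
`(q, r, A, Φ, Ψ) ↦ (r, q, A⁻¹, Ψ, Φ)`, which sends `F` to a constant multiple of `F` and `G` to the
same multiple of `H` (`exists_inv_eq`); this gives the equation for `H`.

The coupled system for `G / F` and `H / F` follows from the quotient rule, and conjugation by `P`
multiplies every Casoratian by `det P`.
-/

/-! ### Determinants as functions of their columns -/

section ColDet

variable {N : ℕ}

lemma colDet_eq_detRowAlternating (c : Fin N → Fin N → ℂ) :
    colDet c = Matrix.detRowAlternating c := by
  rw [colDet, ← Matrix.det_transpose]; rfl

lemma colDet_update_add (c : Fin N → Fin N → ℂ) (j : Fin N) (u v : Fin N → ℂ) :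
    colDet (Function.update c j (u + v)) =
      colDet (Function.update c j u) + colDet (Function.update c j v) := by
  simp only [colDet_eq_detRowAlternating, AlternatingMap.map_update_add]

lemma colDet_update_sub (c : Fin N → Fin N → ℂ) (j : Fin N) (u v : Fin N → ℂ) :
    colDet (Function.update c j (u - v)) =
      colDet (Function.update c j u) - colDet (Function.update c j v) := by
  simp only [colDet_eq_detRowAlternating, AlternatingMap.map_update_sub]

lemma colDet_update_smul (c : Fin N → Fin N → ℂ) (j : Fin N) (k : ℂ) (u : Fin N → ℂ) :
    colDet (Function.update c j (k • u)) = k * colDet (Function.update c j u) := by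
  simp only [colDet_eq_detRowAlternating, AlternatingMap.map_update_smul, smul_eq_mul]

lemma colDet_eq_zero {c : Fin N → Fin N → ℂ} {i j : Fin N} (h : c i = c j) (hij : i ≠ j) :
    colDet c = 0 := by
  rw [colDet_eq_detRowAlternating]
  exact AlternatingMap.map_eq_zero_of_eq _ c h hij

lemma colDet_update_eq_zero {c : Fin N → Fin N → ℂ} {j : Fin N} {v : Fin N → ℂ} (i : Fin N)
    (hij : i ≠ j) (h : v = c i) : colDet (Function.update c j v) = 0 :=
  colDet_eq_zero (i := i) (j := j) (by simp [hij, h]) hij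

lemma colDet_comp_perm (c : Fin N → Fin N → ℂ) (σ : Equiv.Perm (Fin N)) :
    colDet (fun j => c (σ j)) = ((Equiv.Perm.sign σ : ℤ) : ℂ) * colDet c := by
  have := AlternatingMap.map_perm (Matrix.detRowAlternating (n := Fin N) (R := ℂ)) c σ
  rw [colDet_eq_detRowAlternating, colDet_eq_detRowAlternating]
  refine this.trans ?_
  rw [Units.smul_def, zsmul_eq_mul]

lemma colDet_mulVec (B : Matrix (Fin N) (Fin N) ℂ) (c : Fin N → Fin N → ℂ) :
    colDet (fun j => B *ᵥ c j) = B.det * colDet c := by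
  rw [colDet, colDet, ← Matrix.det_mul]
  rfl

/-- Simultaneous column operations: each column with index in `S` is rescaled by `d` and changed
by a multiple of a column whose index lies outside `S`. -/
lemma colDet_column_operations (S : Finset (Fin N)) (d : ℂ) {c c' : Fin N → Fin N → ℂ}
    (hS : ∀ j ∈ S, c' j = d • c j ∨ ∃ i ∉ S, ∃ k : ℂ, c' j = d • c j + k • c i)
    (hS' : ∀ j ∉ S, c' j = c j) :
    colDet c' = d ^ S.card * colDet c := by
  induction S using Finset.induction_on generalizing c' with
  | empty => simp [show c' = c from funext fun j => hS' j (by simp)]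
  | insert i S hi ih =>
    have h1 := ih (c' := Function.update c' i (c i))
      (fun j hj => by
        rw [Function.update_of_ne (by rintro rfl; exact hi hj)]
        exact (hS j (Finset.mem_insert_of_mem hj)).imp_right fun ⟨l, hl, h⟩ =>
          ⟨l, fun hl' => hl (Finset.mem_insert_of_mem hl'), h⟩)
      (fun j hj => by
        by_cases hji : j = i
        · subst hji; simp
        · rw [Function.update_of_ne hji]
          exact hS' j (by simp [hji, hj]))
    have h2 : colDet c' = d * colDet (Function.update c' i (c i)) := by
      rcases hS i (Finset.mem_insert_self i S) with h | ⟨l, hl, k, h⟩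
      · rw [← colDet_update_smul, ← h, Function.update_eq_self]
      · have h3 : colDet (Function.update c' i (c l)) = 0 := by
          refine colDet_update_eq_zero l ?_ (hS' _ hl).symm
          rintro rfl; exact hl (Finset.mem_insert_self l S)
        have h4 := colDet_update_add c' i (d • c i) (k • c l)
        rwa [← h, Function.update_eq_self, colDet_update_smul, colDet_update_smul, h3, mul_zero,
          add_zero] at h4
    rw [h2, h1, Finset.card_insert_of_notMem hi]
    ring

lemma card_filter_val_Ico {a b : ℕ} (hb : b ≤ N) :
    (Finset.univ.filter fun j : Fin N => a ≤ (j : ℕ) ∧ (j : ℕ) < b).card = b - a := by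
  rw [← Nat.card_Ico, ← Finset.card_map Fin.valEmbedding]
  congr 1
  ext k
  simp only [Finset.mem_map, Finset.mem_filter, Finset.mem_univ, true_and, Fin.valEmbedding_apply,
    Finset.mem_Ico]
  exact ⟨by rintro ⟨j, hj, rfl⟩; exact hj, fun hk => ⟨⟨k, by omega⟩, hk, rfl⟩⟩

lemma colDet_updateCol (c : Fin N → Fin N → ℂ) (j : Fin N) (v : Fin N → ℂ) :
    colDet (Function.update c j v) = ((Matrix.of fun i l => c l i).updateCol j v).det := by
  rw [colDet]
  congr 1
  ext i l
  by_cases h : l = j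
  · subst h; simp
  · simp [h]

/-- Applying `B` to one column at a time and summing gives the trace of `B`. -/
lemma sum_colDet_update_mulVec (B : Matrix (Fin N) (Fin N) ℂ) (c : Fin N → Fin N → ℂ) :
    ∑ j, colDet (Function.update c j (B *ᵥ c j)) = B.trace * colDet c := by
  have h : ∀ j, colDet (Function.update c j (B *ᵥ c j)) =
      ((Matrix.of fun i l => c l i).adjugate * (B * Matrix.of fun i l => c l i)) j j := by
    intro j
    rw [colDet_updateCol, ← Matrix.cramer_apply, Matrix.cramer_eq_adjugate_mulVec]
    rfl
  simp only [h]
  change Matrix.trace _ = _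
  rw [Matrix.trace_mul_comm, Matrix.mul_assoc, Matrix.mul_adjugate]
  simp [colDet, mul_comm]

/-- The three-term Plücker relation among the determinants that differ in the columns `i`, `j`. -/
lemma colDet_plucker (c : Fin N → Fin N → ℂ) {i j : Fin N} (hij : i ≠ j) (D : (Fin N → ℂ) →
    (Fin N → ℂ) → ℂ) (hD : ∀ u v, D u v = colDet (Function.update (Function.update c i u) j v))
    (p q r s : Fin N → ℂ) :
    D p q * D r s - D p r * D q s + D p s * D q r = 0 := by
  set M : Matrix (Fin N) (Fin N) ℂ :=
    Matrix.of fun k l => Function.update (Function.update c i p) j q l k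
  have hanti : ∀ u v, D u v = - D v u := by
    intro u v
    have := colDet_comp_perm (Function.update (Function.update c i v) j u) (Equiv.swap i j)
    rw [Equiv.Perm.sign_swap hij] at this
    rw [hD, hD]
    push_cast at this
    rw [neg_one_mul] at this
    rw [← this]
    congr 1
    ext l : 1
    by_cases h1 : l = i
    · subst h1; simp [hij]
    by_cases h2 : l = j
    · subst h2; simp [hij]
    · simp [h1, h2, Equiv.swap_apply_of_ne_of_ne h1 h2]
  -- Cramer's rule expands `det M • r` in the columns of `M`; the linear functional `D · s` kills
  -- every column but `p` and `q`.
  have hcr : ∑ l, colDet (Function.update (Function.update (Function.update c i p) j q) l r) *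
      D (Function.update (Function.update c i p) j q l) s = D p q * D r s := by
    have h := Matrix.mulVec_cramer M r
    let Λ : (Fin N → ℂ) →ₗ[ℂ] ℂ :=
      { toFun := fun u => D u s
        map_add' := fun u v => by
          simp only [hD, Function.update_comm hij, colDet_update_add]
        map_smul' := fun k u => by
          simp only [hD, Function.update_comm hij, colDet_update_smul]; rfl }
    have h2 := congrArg Λ h
    rw [Matrix.mulVec_eq_sum, map_sum, map_smul] at h2
    have h3 : M.det = D p q := by rw [hD, colDet]
    rw [h3] at h2
    refine Eq.trans (Finset.sum_congr rfl fun l _ => ?_) h2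
    rw [colDet_updateCol, op_smul_eq_smul, map_smul, Matrix.cramer_apply]
    rfl
  have h0 : ∀ l, l ≠ i → l ≠ j → D (Function.update (Function.update c i p) j q l) s = 0 := by
    intro l h1 h2
    rw [hD, Function.update_comm hij]
    refine colDet_update_eq_zero l h1 ?_
    simp [h1, h2]
  rw [← Finset.add_sum_erase _ _ (Finset.mem_univ i),
    ← Finset.add_sum_erase _ _ (Finset.mem_erase.2 ⟨hij.symm, Finset.mem_univ j⟩),
    Finset.sum_eq_zero (fun l hl => by
      simp only [Finset.mem_erase, Finset.mem_univ, and_true] at hl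
      rw [h0 l hl.2 hl.1, mul_zero])] at hcr
  rw [Function.update_comm hij.symm, Function.update_idem, ← hD, Function.update_idem, ← hD] at hcr
  simp only [Function.update_self, Function.update_of_ne hij] at hcr
  rw [← hcr, hanti q r]
  ring

lemma hasDerivAt_colDet {c : Fin N → ℝ → Fin N → ℂ} {c' : Fin N → Fin N → ℂ} {t : ℝ}
    (h : ∀ j, HasDerivAt (c j) (c' j) t) :
    HasDerivAt (fun τ => colDet fun j => c j τ)
      (∑ j, colDet (Function.update (fun j => c j t) j (c' j))) t := by
  let f : ContinuousMultilinearMap ℂ (fun _ : Fin N => Fin N → ℂ) ℂ :=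
    { (Matrix.detRowAlternating (n := Fin N) (R := ℂ)).toMultilinearMap with
      cont := (continuous_id (X := Matrix (Fin N) (Fin N) ℂ)).matrix_det }
  have hf : ∀ v : Fin N → Fin N → ℂ, f v = colDet v := fun v =>
    (colDet_eq_detRowAlternating v).symm
  have h1 : HasDerivAt (fun τ j => c j τ) c' t := hasDerivAt_pi.2 h
  have h2 := ((f.hasFDerivAt (x := fun j => c j t)).restrictScalars ℝ).comp_hasDerivAt t h1
  rw [ContinuousLinearMap.coe_restrictScalars', ContinuousMultilinearMap.linearDeriv_apply] at h2
  simp only [hf] at h2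
  rwa [show f ∘ (fun τ j => c j τ) = fun τ => colDet fun j => c j τ from
    funext fun τ => hf _] at h2

end ColDet

/-! ### The bracket and its rearrangements -/

section Bracket

variable {m : ℕ}

/-- The determinant `|u, x₂, x₄, …, x₂ₘ; v, y₁, y₃, …, y₂ₘ₋₁|` as a function of the two columns
`u` and `v`. -/
noncomputable def bracket (x y : ℤ → Fin (2 * m + 2) → ℂ) (u v : Fin (2 * m + 2) → ℂ) : ℂ :=
  colDet fun j : Fin (2 * m + 2) =>
    if (j : ℕ) = 0 then u else if (j : ℕ) < m + 1 then x (2 * (j : ℕ))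
    else if (j : ℕ) = m + 1 then v else y (2 * (j : ℕ) - 2 * m - 3)

/-- The determinant `|x₁, x₃, …, x₂ₘ₊₁; y₀, y₂, …, y₂ₘ|`. -/
noncomputable def casoratian (x y : ℤ → Fin (2 * m + 2) → ℂ) : ℂ :=
  colDet fun j : Fin (2 * m + 2) =>
    if (j : ℕ) < m + 1 then x (2 * (j : ℕ) + 1) else y (2 * (j : ℕ) - 2 * m - 2)

variable (x y : ℤ → Fin (2 * m + 2) → ℂ) (u v w : Fin (2 * m + 2) → ℂ)

/-- The columns `0` and `m + 1` of `c` play no role: they are overwritten by `u` and `v`. -/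
lemma bracket_eq_update (c : Fin (2 * m + 2) → Fin (2 * m + 2) → ℂ)
    (hx : ∀ j : Fin (2 * m + 2), 0 < (j : ℕ) → (j : ℕ) < m + 1 → c j = x (2 * (j : ℕ)))
    (hy : ∀ j : Fin (2 * m + 2), m + 1 < (j : ℕ) → c j = y (2 * (j : ℕ) - 2 * m - 3)) :
    bracket x y u v = colDet (Function.update (Function.update c 0 u) ⟨m + 1, by omega⟩ v) := by
  unfold bracket
  congr 1
  ext j : 1
  by_cases h1 : j = ⟨m + 1, by omega⟩
  · subst h1; simp
  rw [Function.update_of_ne h1]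
  have h1' : (j : ℕ) ≠ m + 1 := fun h => h1 (Fin.ext h)
  by_cases h2 : j = 0
  · subst h2; simp
  have h2' : (j : ℕ) ≠ 0 := fun h => h2 (Fin.ext h)
  rw [Function.update_of_ne h2, if_neg h2']
  by_cases h3 : (j : ℕ) < m + 1
  · rw [if_pos h3, hx j (by omega) h3]
  · rw [if_neg h3, if_neg h1', hy j (by omega)]

lemma exists_bracket_eq_update : ∃ c : Fin (2 * m + 2) → Fin (2 * m + 2) → ℂ,
    ∀ u v, bracket x y u v =
      colDet (Function.update (Function.update c 0 u) ⟨m + 1, by omega⟩ v) :=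
  ⟨_, fun u v => bracket_eq_update x y u v
    (fun j => if (j : ℕ) < m + 1 then x (2 * (j : ℕ)) else y (2 * (j : ℕ) - 2 * m - 3))
    (fun j _ h => if_pos h) (fun j h => if_neg (by omega))⟩

lemma zero_ne_mk_add_one : (0 : Fin (2 * m + 2)) ≠ ⟨m + 1, by omega⟩ := by
  intro h; simpa using congrArg Fin.val h

lemma bracket_plucker (p q r s : Fin (2 * m + 2) → ℂ) :
    bracket x y p q * bracket x y r s - bracket x y p r * bracket x y q s +
      bracket x y p s * bracket x y q r = 0 := by
  obtain ⟨c, hc⟩ := exists_bracket_eq_update x y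
  exact colDet_plucker c zero_ne_mk_add_one _ hc p q r s

lemma bracket_self : bracket x y u u = 0 := by
  have h := bracket_plucker x y u u u u
  simpa using h

lemma bracket_add_left : bracket x y (u + v) w = bracket x y u w + bracket x y v w := by
  obtain ⟨c, hc⟩ := exists_bracket_eq_update x y
  simp only [hc, Function.update_comm zero_ne_mk_add_one, colDet_update_add]

lemma bracket_sub_left : bracket x y (u - v) w = bracket x y u w - bracket x y v w := by
  obtain ⟨c, hc⟩ := exists_bracket_eq_update x y
  simp only [hc, Function.update_comm zero_ne_mk_add_one, colDet_update_sub]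

lemma bracket_smul_left (k : ℂ) : bracket x y (k • u) w = k * bracket x y u w := by
  obtain ⟨c, hc⟩ := exists_bracket_eq_update x y
  simp only [hc, Function.update_comm zero_ne_mk_add_one, colDet_update_smul]

lemma bracket_add_right : bracket x y w (u + v) = bracket x y w u + bracket x y w v := by
  obtain ⟨c, hc⟩ := exists_bracket_eq_update x y
  simp only [hc, colDet_update_add]

lemma bracket_smul_right (k : ℂ) : bracket x y w (k • u) = k * bracket x y w u := by
  obtain ⟨c, hc⟩ := exists_bracket_eq_update x y
  simp only [hc, colDet_update_smul]

lemma bracket_swap : bracket x y u v = -bracket x y v u := by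
  have h := bracket_self x y (u + v)
  rw [bracket_add_left, bracket_add_right, bracket_add_right, bracket_self, bracket_self] at h
  linear_combination h

lemma val_cycleIcc_of_ge_of_lt {n : ℕ} {i j k : Fin n} (hik : i ≤ k) (hkj : k < j) :
    ((Fin.cycleIcc i j k : Fin n) : ℕ) = k + 1 := by
  have : NeZero n := ⟨by have := k.2; omega⟩
  rw [Fin.cycleIcc_of_ge_of_lt hik hkj, Fin.val_add_one_of_lt' (by have := j.2; omega)]

/-- The column `v` of the bracket moved to the end. -/
lemma colDet_eq_bracket_of_last :
    (colDet fun j : Fin (2 * m + 2) =>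
      if (j : ℕ) = 0 then u else if (j : ℕ) < m + 1 then x (2 * (j : ℕ))
      else if (j : ℕ) < 2 * m + 1 then y (2 * (j : ℕ) - 2 * m - 1) else v) =
    (-1) ^ m * bracket x y u v := by
  have hle : (⟨m + 1, by omega⟩ : Fin (2 * m + 2)) ≤ Fin.last (2 * m + 1) := Fin.le_last _
  have hsign : ((Equiv.Perm.sign (Fin.cycleIcc (⟨m + 1, by omega⟩ : Fin (2 * m + 2))
      (Fin.last (2 * m + 1))) : ℤ) : ℂ) = (-1) ^ m := by
    rw [Fin.sign_cycleIcc_of_le hle, show ((Fin.last (2 * m + 1) : Fin (2 * m + 2)) : ℕ) -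
      ((⟨m + 1, by omega⟩ : Fin (2 * m + 2)) : ℕ) = m by simp; omega]
    simp
  rw [← hsign, bracket, ← colDet_comp_perm]
  congr 1
  ext j : 1
  rcases lt_or_ge (j : ℕ) (m + 1) with h | h
  · rw [Fin.cycleIcc_of_lt (by exact h)]
    simp [h]
  rcases lt_or_ge (j : ℕ) (2 * m + 1) with h' | h'
  · rw [val_cycleIcc_of_ge_of_lt (by exact h) (by exact h')]
    rw [if_neg (by omega), if_neg (by omega), if_pos h', if_neg (by omega), if_neg (by omega),
      if_neg (by omega)]
    congr 1; push_cast; ring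
  · have hj : j = Fin.last (2 * m + 1) := Fin.ext (by simp; omega)
    rw [hj, Fin.cycleIcc_of_last hle]
    simp
    omega

/-- The column `u` of the bracket moved next to the column `v`. -/
lemma colDet_eq_bracket_of_mid :
    (colDet fun j : Fin (2 * m + 2) =>
      if (j : ℕ) < m then x (2 * (j : ℕ) + 2) else if (j : ℕ) = m then u
      else if (j : ℕ) = m + 1 then v else y (2 * (j : ℕ) - 2 * m - 3)) =
    (-1) ^ m * bracket x y u v := by
  have hsign : ((Equiv.Perm.sign (Fin.cycleRange (⟨m, by omega⟩ : Fin (2 * m + 2))) : ℤ) : ℂ) =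
      (-1) ^ m := by
    rw [Fin.sign_cycleRange]; simp
  rw [← hsign, bracket, ← colDet_comp_perm]
  congr 1
  ext j : 1
  rcases lt_trichotomy (j : ℕ) m with h | h | h
  · rw [Fin.coe_cycleRange_of_lt (by exact h)]
    rw [if_pos h, if_neg (by omega), if_pos (by omega)]
    congr 1
  · rw [Fin.cycleRange_of_eq (Fin.ext h)]
    simp [h]
  · rw [Fin.cycleRange_of_gt (by exact h)]
    rw [if_neg (by omega), if_neg (by omega), if_neg (by omega : ¬ (j : ℕ) = 0),
      if_neg (by omega : ¬ (j : ℕ) < m + 1)]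

/-- Both columns `u` and `v` of the bracket moved to the ends of their blocks: the signs cancel. -/
lemma colDet_eq_bracket_of_mid_last :
    (colDet fun j : Fin (2 * m + 2) =>
      if (j : ℕ) < m then x (2 * (j : ℕ) + 2) else if (j : ℕ) = m then u
      else if (j : ℕ) < 2 * m + 1 then y (2 * (j : ℕ) - 2 * m - 1) else v) =
    bracket x y u v := by
  have hsign : ((Equiv.Perm.sign (Fin.cycleRange (⟨m, by omega⟩ : Fin (2 * m + 2))) : ℤ) : ℂ) =
      (-1) ^ m := by
    rw [Fin.sign_cycleRange]; simp
  have hone : ((-1) ^ m * (-1) ^ m : ℂ) = 1 := by rw [← mul_pow]; simp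
  rw [← one_mul (bracket x y u v), ← hone, mul_assoc, ← colDet_eq_bracket_of_last]
  nth_rw 1 [← hsign]
  rw [← colDet_comp_perm]
  congr 1
  ext j : 1
  rcases lt_trichotomy (j : ℕ) m with h | h | h
  · rw [Fin.coe_cycleRange_of_lt (by exact h)]
    rw [if_pos h, if_neg (by omega), if_pos (by omega)]
    congr 1
  · rw [Fin.cycleRange_of_eq (Fin.ext h)]
    simp [h]
  · rw [Fin.cycleRange_of_gt (by exact h)]
    rw [if_neg (by omega), if_neg (by omega), if_neg (by omega : ¬ (j : ℕ) = 0),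
      if_neg (by omega : ¬ (j : ℕ) < m + 1)]

/-- The column `v` of the bracket moved next to the column `u`. -/
lemma colDet_eq_bracket_of_second :
    (colDet fun j : Fin (2 * m + 2) =>
      if (j : ℕ) = 0 then u else if (j : ℕ) = 1 then v
      else if (j : ℕ) < m + 2 then x (2 * (j : ℕ) - 2) else y (2 * (j : ℕ) - 2 * m - 3)) =
    (-1) ^ m * bracket x y u v := by
  have hle : (1 : Fin (2 * m + 2)) ≤ ⟨m + 1, by omega⟩ := by
    rw [Fin.le_def]; simp
  have hsign : ((Equiv.Perm.sign (Fin.cycleIcc (1 : Fin (2 * m + 2)) ⟨m + 1, by omega⟩) : ℤ) : ℂ)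
      = (-1) ^ m := by
    rw [Fin.sign_cycleIcc_of_le hle]; simp
  have hone : ((-1) ^ m * (-1) ^ m : ℂ) = 1 := by rw [← mul_pow]; simp
  suffices h : bracket x y u v = (-1) ^ m * colDet fun j : Fin (2 * m + 2) =>
      if (j : ℕ) = 0 then u else if (j : ℕ) = 1 then v
      else if (j : ℕ) < m + 2 then x (2 * (j : ℕ) - 2) else y (2 * (j : ℕ) - 2 * m - 3) by
    rw [h, ← mul_assoc, hone, one_mul]
  rw [← hsign, ← colDet_comp_perm, bracket]
  congr 1
  ext j : 1
  rcases Nat.lt_or_ge (j : ℕ) 1 with h | h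
  · rw [Fin.cycleIcc_of_lt (by rw [Fin.lt_def]; simpa using h)]
    simp [show (j : ℕ) = 0 by omega]
  rcases lt_trichotomy (j : ℕ) (m + 1) with h' | h' | h'
  · rw [val_cycleIcc_of_ge_of_lt (by rw [Fin.le_def]; simpa using h) (by exact h')]
    rw [if_neg (by omega), if_pos h', if_neg (by omega), if_neg (by omega), if_pos (by omega)]
    congr 1; push_cast; ring
  · rw [show j = ⟨m + 1, by omega⟩ from Fin.ext h', Fin.cycleIcc_of_last hle]
    simp
  · rw [Fin.cycleIcc_of_gt (by exact h')]
    rw [if_neg (by omega), if_neg (by omega), if_neg (by omega), if_neg (by omega),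
      if_neg (by omega), if_neg (by omega)]

variable {x y}

/-- The columns of the double Casoratian are `A` times `x₀, …, x₂ₘ; y₋₁, …, y₂ₘ₋₁`. -/
lemma casoratian_eq_lower {A : Matrix (Fin (2 * m + 2)) (Fin (2 * m + 2)) ℂ}
    (hx : ∀ k, A *ᵥ x k = x (k + 1)) (hy : ∀ k, A *ᵥ y k = y (k + 1)) :
    casoratian x y = A.det * bracket x y (x 0) (y (-1)) := by
  rw [bracket, ← colDet_mulVec, casoratian]
  congr 1
  ext j : 1
  split_ifs <;> first | omega | skip
  all_goals first | rw [hx] | rw [hy]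
  all_goals congr 1
  all_goals omega

/-- `A` times the columns of the double Casoratian are `x₂, …, x₂ₘ₊₂; y₁, …, y₂ₘ₊₁`. -/
lemma casoratian_eq_upper {A : Matrix (Fin (2 * m + 2)) (Fin (2 * m + 2)) ℂ}
    (hx : ∀ k, A *ᵥ x k = x (k + 1)) (hy : ∀ k, A *ᵥ y k = y (k + 1)) :
    A.det * casoratian x y = bracket x y (x (2 * m + 2)) (y (2 * m + 1)) := by
  rw [← colDet_eq_bracket_of_mid_last, casoratian, ← colDet_mulVec]
  congr 1
  ext j : 1
  split_ifs <;> first | omega | skip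
  all_goals first | rw [hx] | rw [hy]
  all_goals congr 1
  all_goals omega

end Bracket

/-! ### One step of the spectral problem -/

section LaxStep

variable {m : ℕ}

/-- One step of the spectral problem for the sequences `x k = Aᵏ Φₙ`, `y k = Aᵏ Ψₙ`,
`x' k = Aᵏ Φₙ₊₁`, `y' k = Aᵏ Ψₙ₊₁`, where `s` is a square root of `1 - q r ≠ 0`. -/
structure LaxStep (s q r : ℂ) (x y x' y' : ℤ → Fin (2 * m + 2) → ℂ) : Prop where
  ne : s ≠ 0
  sq : s ^ 2 = 1 - q * r
  hx : ∀ k, s • x' k = x (k + 1) + q • y k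
  hy : ∀ k, s • y' k = r • x k + y (k - 1)

namespace LaxStep

variable {s q r : ℂ} {x y x' y' : ℤ → Fin (2 * m + 2) → ℂ} (E : LaxStep s q r x y x' y')
include E

lemma right_x {k k₁ k₂ : ℤ} (h₁ : k₁ = k + 1) (h₂ : k₂ = k) :
    x' k = s⁻¹ • x k₁ + (s⁻¹ * q) • y k₂ := by
  rw [h₁, h₂, mul_smul, ← smul_add, ← E.hx, inv_smul_smul₀ E.ne]

lemma right_y {k k₁ k₂ : ℤ} (h₁ : k₁ = k - 1) (h₂ : k₂ = k) :
    y' k = s⁻¹ • y k₁ + (s⁻¹ * r) • x k₂ := by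
  rw [h₁, h₂, mul_smul, ← smul_add, add_comm (y _), ← E.hy, inv_smul_smul₀ E.ne]

/-- `Aᵏ Ψₙ₊₁` in terms of `Ψₙ` and `Φₙ₊₁`: eliminating `Φₙ` brings in `1 - q r = s²`. -/
lemma right_y_of_right_x {k k₁ k₂ : ℤ} (h₁ : k₁ = k - 1) (h₂ : k₂ = k - 1) :
    y' k = s • y k₁ + r • x' k₂ := by
  rw [E.right_y (k := k) rfl rfl, E.right_x (k := k₂) (k₁ := k) (by omega) rfl, h₁, h₂]
  have h : s⁻¹ = s + r * (s⁻¹ * q) := by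
    have := E.ne; field_simp; linear_combination -E.sq
  calc _ = (s + r * (s⁻¹ * q)) • y (k - 1) + (s⁻¹ * r) • x k := by rw [← h]
    _ = _ := by module

lemma left_x {k k₁ k₂ : ℤ} (h₁ : k₁ = k - 1) (h₂ : k₂ = k) :
    x k = s⁻¹ • x' k₁ + (-(s⁻¹ * q)) • y' k₂ := by
  rw [E.right_x (k := k₁) (k₁ := k) (by omega) rfl, E.right_y (k := k₂) (k₂ := k) rfl h₂.symm,
    h₁, h₂]
  have h : s⁻¹ * s⁻¹ - s⁻¹ * q * (s⁻¹ * r) = 1 := by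
    have := E.ne; field_simp; linear_combination -E.sq
  calc _ = (s⁻¹ * s⁻¹ - s⁻¹ * q * (s⁻¹ * r)) • x k := by rw [h, one_smul]
    _ = _ := by module

lemma left_y {k k₁ k₂ : ℤ} (h₁ : k₁ = k + 1) (h₂ : k₂ = k) :
    y k = s⁻¹ • y' k₁ + (-(s⁻¹ * r)) • x' k₂ := by
  rw [E.right_y (k := k₁) (k₁ := k) (by omega) rfl, E.right_x (k := k₂) (k₂ := k) rfl h₂.symm,
    h₁, h₂]
  have h : s⁻¹ * s⁻¹ - s⁻¹ * q * (s⁻¹ * r) = 1 := by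
    have := E.ne; field_simp; linear_combination -E.sq
  calc _ = (s⁻¹ * s⁻¹ - s⁻¹ * q * (s⁻¹ * r)) • y k := by rw [h, one_smul]
    _ = _ := by module

lemma pow_mul_inv_pow (k : ℕ) (z : ℂ) : s ^ k * (s⁻¹ ^ k * z) = z := by
  rw [← mul_assoc, ← mul_pow, mul_inv_cancel₀ E.ne, one_pow, one_mul]

/-- The quasi double Casoratian `F` in terms of the left site: the contributions of `q` to the
columns `A²ʲ Φₙ₊₁` are multiples of the columns `A²ʲ Ψₙ`. -/
lemma quasiF_left :
    s ^ (m + 1) * (colDet fun j : Fin (2 * m + 2) =>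
      if (j : ℕ) < m + 1 then x' (2 * (j : ℕ)) else y (2 * (j : ℕ) - 2 * m - 2)) =
    casoratian x y := by
  rw [colDet_column_operations (Finset.univ.filter fun j : Fin (2 * m + 2) =>
    0 ≤ (j : ℕ) ∧ (j : ℕ) < m + 1) s⁻¹ (c := fun j : Fin (2 * m + 2) =>
    if (j : ℕ) < m + 1 then x (2 * (j : ℕ) + 1) else y (2 * (j : ℕ) - 2 * m - 2)),
    card_filter_val_Ico (by omega), Nat.sub_zero, E.pow_mul_inv_pow, casoratian]
  · intro j hj
    have hj' : (j : ℕ) < m + 1 := by simpa using hj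
    refine Or.inr ⟨⟨j + m + 1, by omega⟩, by simp only [Finset.mem_filter]; omega, s⁻¹ * q, ?_⟩
    rw [if_pos hj', if_pos hj', if_neg (by dsimp only; omega)]
    exact E.right_x rfl (by push_cast; ring)
  · intro j hj
    have hj' : ¬ (j : ℕ) < m + 1 := by simpa using hj
    rw [if_neg hj', if_neg hj']

/-- The quasi double Casoratian `G` in terms of the left site. -/
lemma quasiG_left :
    s ^ (m + 1) * (colDet fun j : Fin (2 * m + 2) =>
      if (j : ℕ) = 0 then x 0 else if (j : ℕ) < m + 2 then x' (2 * (j : ℕ) - 1)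
      else y (2 * (j : ℕ) - 2 * m - 3)) =
    bracket x y (x 0) (x (2 * m + 2) + q • y (2 * m + 1)) := by
  rw [colDet_column_operations (Finset.univ.filter fun j : Fin (2 * m + 2) =>
    1 ≤ (j : ℕ) ∧ (j : ℕ) < m + 2) s⁻¹ (c := fun j : Fin (2 * m + 2) =>
    if (j : ℕ) = 0 then x 0 else if (j : ℕ) < m + 1 then x (2 * (j : ℕ))
    else if (j : ℕ) = m + 1 then x (2 * m + 2) + q • y (2 * m + 1)
    else y (2 * (j : ℕ) - 2 * m - 3)),
    card_filter_val_Ico (by omega), show m + 2 - 1 = m + 1 by omega, E.pow_mul_inv_pow, bracket]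
  · intro j hj
    have hj' : 1 ≤ (j : ℕ) ∧ (j : ℕ) < m + 2 := by simpa using hj
    rcases Nat.lt_or_ge (j : ℕ) (m + 1) with h | h
    · refine Or.inr ⟨⟨j + m + 1, by omega⟩, by simp only [Finset.mem_filter]; omega, s⁻¹ * q, ?_⟩
      rw [if_neg (by omega), if_pos hj'.2, if_neg (by omega), if_pos h, if_neg (by dsimp only; omega),
        if_neg (by dsimp only; omega), if_neg (by dsimp only; omega)]
      exact E.right_x (by ring) (by push_cast; ring)
    · left
      rw [if_neg (show ¬ (j : ℕ) = 0 by omega), if_pos hj'.2,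
        if_neg (show ¬ (j : ℕ) = 0 by omega), if_neg (show ¬ (j : ℕ) < m + 1 by omega),
        if_pos (show (j : ℕ) = m + 1 by omega), smul_add, smul_smul]
      exact E.right_x (by omega) (by omega)
  · intro j hj
    have hj' : 1 ≤ (j : ℕ) → m + 2 ≤ (j : ℕ) := by simpa using hj
    rcases Nat.eq_zero_or_pos (j : ℕ) with h | h
    · rw [if_pos h, if_pos h]
    · have := hj' h
      rw [if_neg (by omega), if_neg (by omega), if_neg (by omega), if_neg (by omega),
        if_neg (by omega)]

/-- The quasi double Casoratian `H` in terms of the left site. -/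
lemma quasiH_left :
    s ^ (m + 1) * (colDet fun j : Fin (2 * m + 2) =>
      if (j : ℕ) < m then x' (2 * (j : ℕ) + 1) else if (j : ℕ) = m then y' 0
      else y (2 * (j : ℕ) - 2 * m - 1)) =
    bracket x y (y (-1) + r • x 0) (y (2 * m + 1)) := by
  rw [← colDet_eq_bracket_of_mid_last, colDet_column_operations
    (Finset.univ.filter fun j : Fin (2 * m + 2) => 0 ≤ (j : ℕ) ∧ (j : ℕ) < m + 1) s⁻¹
    (c := fun j : Fin (2 * m + 2) =>
    if (j : ℕ) < m then x (2 * (j : ℕ) + 2) else if (j : ℕ) = m then y (-1) + r • x 0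
    else if (j : ℕ) < 2 * m + 1 then y (2 * (j : ℕ) - 2 * m - 1) else y (2 * m + 1)),
    card_filter_val_Ico (by omega), Nat.sub_zero, E.pow_mul_inv_pow]
  · intro j hj
    have hj' : (j : ℕ) < m + 1 := by simpa using hj
    rcases Nat.lt_or_ge (j : ℕ) m with h | h
    · refine Or.inr ⟨⟨j + m + 1, by omega⟩, by simp only [Finset.mem_filter]; omega, s⁻¹ * q, ?_⟩
      rw [if_pos h, if_pos h, if_neg (by dsimp only; omega), if_neg (by dsimp only; omega),
        if_pos (by dsimp only; omega)]
      exact E.right_x (by ring) (by push_cast; ring)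
    · left
      rw [if_neg (by omega), if_pos (by omega), if_neg (by omega), if_pos (by omega), smul_add, smul_smul]
      exact E.right_y (by omega) (by omega)
  · intro j hj
    have hj' : m + 1 ≤ (j : ℕ) := by simpa using hj
    rw [if_neg (by omega), if_neg (by omega), if_neg (by omega), if_neg (by omega)]
    split_ifs with h
    · rfl
    · congr 1; omega

/-- The quasi double Casoratian `F` in terms of the right site. -/
lemma quasiF_right :
    s ^ (m + 1) * (colDet fun j : Fin (2 * m + 2) =>
      if (j : ℕ) < m + 1 then x' (2 * (j : ℕ)) else y (2 * (j : ℕ) - 2 * m - 2)) =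
    (-1) ^ m * bracket x' y' (x' 0) (y' (2 * m + 1)) := by
  rw [← colDet_eq_bracket_of_last, colDet_column_operations
    (Finset.univ.filter fun j : Fin (2 * m + 2) => m + 1 ≤ (j : ℕ) ∧ (j : ℕ) < 2 * m + 2) s⁻¹
    (c := fun j : Fin (2 * m + 2) =>
    if (j : ℕ) = 0 then x' 0 else if (j : ℕ) < m + 1 then x' (2 * (j : ℕ))
      else if (j : ℕ) < 2 * m + 1 then y' (2 * (j : ℕ) - 2 * m - 1) else y' (2 * m + 1)),
    card_filter_val_Ico (by omega), show 2 * m + 2 - (m + 1) = m + 1 by omega, E.pow_mul_inv_pow]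
  · intro j hj
    have hj' : m + 1 ≤ (j : ℕ) := by
      simp only [Finset.mem_filter] at hj; exact hj.2.1
    refine Or.inr ⟨⟨j - (m + 1), by omega⟩, by simp only [Finset.mem_filter]; omega, -(s⁻¹ * r), ?_⟩
    rw [if_neg (by omega), if_neg (by omega), if_neg (by omega)]
    have h1 : (if ((⟨j - (m + 1), by omega⟩ : Fin (2 * m + 2)) : ℕ) = 0 then x' 0
        else x' (2 * ((⟨j - (m + 1), by omega⟩ : Fin (2 * m + 2)) : ℕ))) =
        x' (2 * (j : ℕ) - 2 * m - 2) := by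
      split_ifs with h
      · simp only at h
        congr 1; omega
      · simp only
        congr 1; omega
    have h2 : (if (j : ℕ) < 2 * m + 1 then y' (2 * (j : ℕ) - 2 * m - 1) else y' (2 * m + 1)) =
        y' (2 * (j : ℕ) - 2 * m - 1) := by
      split_ifs with h
      · rfl
      · congr 1; omega
    rw [h2, if_pos (show ((⟨j - (m + 1), by omega⟩ : Fin (2 * m + 2)) : ℕ) < m + 1 by
      simp only; omega), h1]
    exact E.left_y (by ring) rfl
  · intro j hj
    have hj' : (j : ℕ) < m + 1 := by
      simp at hj; omega
    rw [if_pos hj', if_pos hj']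
    split_ifs with h
    · simp [h]
    · rfl

/-- The quasi double Casoratian `G` in terms of the right site. -/
lemma quasiG_right {A : Matrix (Fin (2 * m + 2)) (Fin (2 * m + 2)) ℂ}
    (hx : ∀ k, A *ᵥ x' k = x' (k + 1)) (hy : ∀ k, A *ᵥ y' k = y' (k + 1)) :
    s ^ (m + 1) * (colDet fun j : Fin (2 * m + 2) =>
      if (j : ℕ) = 0 then x 0 else if (j : ℕ) < m + 2 then x' (2 * (j : ℕ) - 1)
      else y (2 * (j : ℕ) - 2 * m - 3)) =
    A.det * ((-1) ^ m * bracket x' y' (x' (-2) - q • y' (-1)) (x' 0)) := by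
  rw [← colDet_eq_bracket_of_second, ← colDet_mulVec, colDet_column_operations
    (Finset.univ.filter fun j : Fin (2 * m + 2) => 1 ≤ (j : ℕ) ∧ (j : ℕ) < m + 2)ᶜ s⁻¹
    (c := fun j : Fin (2 * m + 2) =>
    if (j : ℕ) = 0 then x' (-1) - q • y' 0 else if (j : ℕ) < m + 2 then x' (2 * (j : ℕ) - 1)
      else y' (2 * (j : ℕ) - 2 * m - 2)),
    Finset.card_compl, card_filter_val_Ico (by omega), Fintype.card_fin,
    show 2 * m + 2 - (m + 2 - 1) = m + 1 by omega, E.pow_mul_inv_pow]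
  · congr 1
    ext j : 1
    split_ifs <;> first | omega | skip
    · rw [Matrix.mulVec_sub, Matrix.mulVec_smul, hx, hy]; rfl
    all_goals first | rw [hx] | rw [hy]
    all_goals congr 1
    all_goals omega
  · intro j hj
    have hj' : ¬ (1 ≤ (j : ℕ) ∧ (j : ℕ) < m + 2) := by simpa using hj
    rcases Nat.eq_zero_or_pos (j : ℕ) with h | h
    · left
      rw [if_pos h, if_pos h,
        E.left_x (k := 0) (k₁ := -1) (k₂ := 0) (by omega) rfl]
      module
    · have h' : m + 2 ≤ (j : ℕ) := by omega
      refine Or.inr ⟨⟨j - (m + 1), by omega⟩, by simp; omega, -(s⁻¹ * r), ?_⟩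
      rw [if_neg (by omega), if_neg (by omega), if_neg (by omega), if_neg (by omega),
        if_neg (by dsimp only; omega), if_pos (by dsimp only; omega)]
      exact E.left_y (by ring) (by dsimp only; omega)
  · intro j hj
    have hj' : 1 ≤ (j : ℕ) ∧ (j : ℕ) < m + 2 := by simpa using hj
    rw [if_neg (show ¬ (j : ℕ) = 0 by omega), if_neg (show ¬ (j : ℕ) = 0 by omega), if_pos hj'.2,
      if_pos hj'.2]

/-- The double Casoratian of the right site in terms of the left site. The columns of `Ψₙ₊₁` but
the first are reduced by those of `Φₙ₊₁`, and then these by the remaining columns of `Ψₙ`. -/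
lemma casoratian_right :
    s ^ 2 * casoratian x' y' =
      (-1) ^ m * bracket x y (x (2 * m + 2) + q • y (2 * m + 1)) (y (-1) + r • x 0) := by
  have h1 : casoratian x' y' = s ^ m * colDet fun j : Fin (2 * m + 2) =>
      if (j : ℕ) < m + 1 then x' (2 * (j : ℕ) + 1) else if (j : ℕ) = m + 1 then y' 0
      else y (2 * (j : ℕ) - 2 * m - 3) := by
    rw [casoratian, colDet_column_operations
      (Finset.univ.filter fun j : Fin (2 * m + 2) => m + 2 ≤ (j : ℕ) ∧ (j : ℕ) < 2 * m + 2) s,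
      card_filter_val_Ico le_rfl, show 2 * m + 2 - (m + 2) = m by omega]
    · intro j hj
      have hj' : m + 2 ≤ (j : ℕ) := (Finset.mem_filter.1 hj).2.1
      refine Or.inr ⟨⟨j - (m + 2), by omega⟩, by simp only [Finset.mem_filter]; omega, r, ?_⟩
      rw [if_neg (by omega), if_neg (by omega), if_neg (by omega), if_pos (by dsimp only; omega)]
      exact E.right_y_of_right_x (by ring) (by dsimp only; omega)
    · intro j hj
      have hj' : (j : ℕ) < m + 2 := by
        simp only [Finset.mem_filter, Finset.mem_univ, true_and] at hj; omega
      split_ifs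
      · rfl
      · congr 1; omega
      · omega
  have h2 := colDet_eq_bracket_of_mid x y (x (2 * m + 2) + q • y (2 * m + 1)) (y (-1) + r • x 0)
  rw [h1, ← h2, colDet_column_operations
    (Finset.univ.filter fun j : Fin (2 * m + 2) => 0 ≤ (j : ℕ) ∧ (j : ℕ) < m + 2) s⁻¹
    (c := fun j : Fin (2 * m + 2) =>
      if (j : ℕ) < m then x (2 * (j : ℕ) + 2)
      else if (j : ℕ) = m then x (2 * m + 2) + q • y (2 * m + 1)
      else if (j : ℕ) = m + 1 then y (-1) + r • x 0 else y (2 * (j : ℕ) - 2 * m - 3)),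
    card_filter_val_Ico (by omega), Nat.sub_zero, ← mul_assoc, ← pow_add, add_comm 2 m,
    E.pow_mul_inv_pow]
  · intro j hj
    have hj' : (j : ℕ) < m + 2 := (Finset.mem_filter.1 hj).2.2
    rcases lt_trichotomy (j : ℕ) m with h | h | h
    · refine Or.inr ⟨⟨j + m + 2, by omega⟩, by simp only [Finset.mem_filter]; omega, s⁻¹ * q, ?_⟩
      rw [if_pos (by omega), if_pos (by omega), if_neg (by dsimp only; omega),
        if_neg (by dsimp only; omega), if_neg (by dsimp only; omega)]
      exact E.right_x (by ring) (by push_cast; ring)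
    · left
      rw [if_pos (by omega), if_neg (by omega), if_pos h, smul_add, smul_smul]
      exact E.right_x (by omega) (by omega)
    · left
      rw [if_neg (by omega), if_pos (by omega), if_neg (by omega), if_neg (by omega),
        if_pos (by omega), smul_add, smul_smul]
      exact E.right_y (by omega) (by omega)
  · intro j hj
    have hj' : m + 2 ≤ (j : ℕ) := by
      simp only [Finset.mem_filter, Finset.mem_univ, true_and] at hj; omega
    rw [if_neg (by omega), if_neg (by omega), if_neg (by omega), if_neg (by omega),
      if_neg (by omega)]

/-- The reduced form of the quasi double Casoratian `G` of the right site in terms of the left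
site; `q₁` is the potential at the right site. -/
lemma bracket_right {A : Matrix (Fin (2 * m + 2)) (Fin (2 * m + 2)) ℂ}
    (hx : ∀ k, A *ᵥ x k = x (k + 1)) (hy : ∀ k, A *ᵥ y k = y (k + 1)) (q₁ : ℂ) :
    A.det * (s ^ 2 * bracket x' y' (x' 0) (x' (2 * m + 2) + q₁ • y' (2 * m + 1))) =
      (-1) ^ m * bracket x y (x (2 * m + 2) + q • y (2 * m + 1))
        (x (2 * m + 4) + q • y (2 * m + 3) + (s ^ 2 * q₁) • y (2 * m + 1)) := by
  have h1 : bracket x' y' (x' 0) (x' (2 * m + 2) + q₁ • y' (2 * m + 1)) =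
      s ^ m * colDet fun j : Fin (2 * m + 2) =>
        if (j : ℕ) < m + 1 then x' (2 * (j : ℕ))
        else if (j : ℕ) = m + 1 then x' (2 * m + 2) + q₁ • y' (2 * m + 1)
        else y (2 * (j : ℕ) - 2 * m - 4) := by
    rw [bracket, colDet_column_operations
      (Finset.univ.filter fun j : Fin (2 * m + 2) => m + 2 ≤ (j : ℕ) ∧ (j : ℕ) < 2 * m + 2) s,
      card_filter_val_Ico le_rfl, show 2 * m + 2 - (m + 2) = m by omega]
    · intro j hj
      have hj' : m + 2 ≤ (j : ℕ) := (Finset.mem_filter.1 hj).2.1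
      refine Or.inr ⟨⟨j - (m + 2), by omega⟩, by simp only [Finset.mem_filter]; omega, r, ?_⟩
      rw [if_neg (by omega), if_neg (by omega), if_neg (by omega), if_neg (by omega),
        if_neg (by omega), if_pos (by dsimp only; omega)]
      exact E.right_y_of_right_x (by ring) (by dsimp only; omega)
    · intro j hj
      have hj' : (j : ℕ) < m + 2 := by
        simp only [Finset.mem_filter, Finset.mem_univ, true_and] at hj; omega
      split_ifs <;> first | omega | rfl | skip
      congr 1; omega
  -- The column `A²ᵐ Φₙ₊₁` completes the contribution of `q₁` to a multiple of `1 - q r`.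
  have h2 : (colDet fun j : Fin (2 * m + 2) =>
        if (j : ℕ) < m + 1 then x' (2 * (j : ℕ))
        else if (j : ℕ) = m + 1 then x' (2 * m + 2) + q₁ • y' (2 * m + 1)
        else y (2 * (j : ℕ) - 2 * m - 4)) =
      colDet fun j : Fin (2 * m + 2) =>
        if (j : ℕ) < m + 1 then x' (2 * (j : ℕ))
        else if (j : ℕ) = m + 1 then x' (2 * m + 2) + (q₁ * s) • y (2 * m)
        else y (2 * (j : ℕ) - 2 * m - 4) := by
    rw [colDet_column_operations {⟨m + 1, by omega⟩} 1, one_pow, one_mul]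
    · intro j hj
      have hj' : (j : ℕ) = m + 1 := congrArg Fin.val (Finset.mem_singleton.1 hj)
      refine Or.inr ⟨⟨m, by omega⟩, by simp, q₁ * r, ?_⟩
      rw [if_neg (by omega), if_pos hj', if_neg (by omega), if_pos hj',
        if_pos (by dsimp only; omega),
        E.right_y_of_right_x (k₁ := 2 * m) (k₂ := 2 * m) (by omega) (by omega)]
      module
    · intro j hj
      have hj' : ¬ (j : ℕ) = m + 1 := fun h => hj (Finset.mem_singleton.2 (Fin.ext h))
      rw [if_neg hj', if_neg hj']
  have h3 := colDet_eq_bracket_of_mid x y (x (2 * m + 2) + q • y (2 * m + 1))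
    (x (2 * m + 4) + q • y (2 * m + 3) + (s ^ 2 * q₁) • y (2 * m + 1))
  have h4 : (colDet fun j : Fin (2 * m + 2) =>
        if (j : ℕ) < m + 1 then x' (2 * (j : ℕ))
        else if (j : ℕ) = m + 1 then x' (2 * m + 2) + (q₁ * s) • y (2 * m)
        else y (2 * (j : ℕ) - 2 * m - 4)) =
      s⁻¹ ^ (m + 2) * colDet fun j : Fin (2 * m + 2) =>
        if (j : ℕ) < m then x (2 * (j : ℕ) + 1)
        else if (j : ℕ) = m then x (2 * m + 1) + q • y (2 * m)
        else if (j : ℕ) = m + 1 then x (2 * m + 3) + q • y (2 * m + 2) + (s ^ 2 * q₁) • y (2 * m)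
        else y (2 * (j : ℕ) - 2 * m - 4) := by
    rw [colDet_column_operations
      (Finset.univ.filter fun j : Fin (2 * m + 2) => 0 ≤ (j : ℕ) ∧ (j : ℕ) < m + 2) s⁻¹,
      card_filter_val_Ico (by omega), Nat.sub_zero]
    · intro j hj
      have hj' : (j : ℕ) < m + 2 := (Finset.mem_filter.1 hj).2.2
      rcases lt_trichotomy (j : ℕ) m with h | h | h
      · refine Or.inr ⟨⟨j + m + 2, by omega⟩, by simp only [Finset.mem_filter]; omega,
          s⁻¹ * q, ?_⟩
        rw [if_pos (by omega), if_pos (by omega), if_neg (by dsimp only; omega),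
          if_neg (by dsimp only; omega), if_neg (by dsimp only; omega)]
        exact E.right_x (by ring) (by push_cast; ring)
      · left
        rw [if_pos (by omega), if_neg (by omega), if_pos h, smul_add, smul_smul]
        exact E.right_x (by omega) (by omega)
      · left
        rw [if_neg (by omega), if_pos (by omega), if_neg (by omega), if_neg (by omega),
          if_pos (by omega), E.right_x (k := 2 * m + 2) (k₁ := 2 * m + 3) (by omega) rfl,
          show q₁ * s = s⁻¹ * (s ^ 2 * q₁) by have := E.ne; field_simp]
        module
    · intro j hj
      have hj' : m + 2 ≤ (j : ℕ) := by
        simp only [Finset.mem_filter, Finset.mem_univ, true_and] at hj; omega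
      rw [if_neg (by omega), if_neg (by omega), if_neg (by omega), if_neg (by omega),
        if_neg (by omega)]
  have h5 : ∀ z, s ^ 2 * (s ^ m * (s⁻¹ ^ (m + 2) * z)) = z := fun z => by
    rw [← mul_assoc, ← pow_add, add_comm 2 m, E.pow_mul_inv_pow]
  rw [h1, h2, h4, ← h3, h5, ← colDet_mulVec]
  congr 1
  ext j : 1
  split_ifs
  · rw [hx]; congr 1
  · rw [Matrix.mulVec_add, Matrix.mulVec_smul, hx, hy]; congr 2
  · rw [Matrix.mulVec_add, Matrix.mulVec_add, Matrix.mulVec_smul, Matrix.mulVec_smul, hx, hy, hy,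
      show (2 * m + 3 + 1 : ℤ) = 2 * m + 4 by ring, show (2 * m + 2 + 1 : ℤ) = 2 * m + 3 by ring]
  · rw [hy]; congr 1; ring

end LaxStep

end LaxStep

/-! ### Time derivatives -/

section LaxFlow

variable {m : ℕ}

/-- Columns that evolve by `cⱼ' = eⱼ - ½ B cⱼ`: the common part `-½ B` contributes its trace. -/
lemma hasDerivAt_colDet_sub_mulVec {N : ℕ} {c : Fin N → ℝ → Fin N → ℂ} {e : Fin N → Fin N → ℂ}
    {t : ℝ} (B : Matrix (Fin N) (Fin N) ℂ)
    (h : ∀ j, HasDerivAt (c j) (e j - (2 : ℂ)⁻¹ • (B *ᵥ c j t)) t) :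
    HasDerivAt (fun τ => colDet fun j => c j τ)
      ((∑ j, colDet (Function.update (fun j => c j t) j (e j))) -
        2⁻¹ * (B.trace * colDet fun j => c j t)) t := by
  convert hasDerivAt_colDet h using 1
  simp only [colDet_update_sub, colDet_update_smul]
  rw [Finset.sum_sub_distrib, ← Finset.mul_sum, sum_colDet_update_mulVec B fun j => c j t]

lemma sum_ite_lt_half (g : ℂ) :
    ∑ j : Fin (2 * m + 2), (if (j : ℕ) < m + 1 then g else -g) = 0 := by
  rw [Fin.sum_univ_eq_sum_range (fun j => if j < m + 1 then g else -g) (2 * m + 2),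
    show 2 * m + 2 = (m + 1) + (m + 1) by ring, Finset.sum_range_add,
    Finset.sum_congr rfl (fun j hj => if_pos (Finset.mem_range.1 hj)),
    Finset.sum_congr (s₁ := Finset.range (m + 1)) rfl
      (fun j _ => if_neg (show ¬ m + 1 + j < m + 1 by omega))]
  simp

/-- The time evolution at `t` of the sequences `x k = Aᵏ Φₙ`, `y k = Aᵏ Ψₙ`, where `q`, `r` are the
potentials at `n`, `q₀`, `r₀` those at `n - 1`, and `B = A² - A⁻²`. -/
structure LaxFlow (A B : Matrix (Fin (2 * m + 2)) (Fin (2 * m + 2)) ℂ) (q r q₀ r₀ : ℂ)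
    (x y : ℤ → ℝ → Fin (2 * m + 2) → ℂ) (t : ℝ) : Prop where
  hx : ∀ k, A *ᵥ x k t = x (k + 1) t
  hy : ∀ k, A *ᵥ y k t = y (k + 1) t
  hBx : ∀ k, B *ᵥ x k t = x (k + 2) t - x (k - 2) t
  hBy : ∀ k, B *ᵥ y k t = y (k + 2) t - y (k - 2) t
  deriv_x : ∀ k, HasDerivAt (x k) ((2 : ℂ)⁻¹ • (x (k + 2) t - x (k - 2) t) +
    ((r * q₀ - q * r₀) / 2) • x k t + q • y (k + 1) t + q₀ • y (k - 1) t) t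
  deriv_y : ∀ k, HasDerivAt (y k) (r₀ • x (k + 1) t + r • x (k - 1) t -
    (2 : ℂ)⁻¹ • (y (k + 2) t - y (k - 2) t) - ((r * q₀ - q * r₀) / 2) • y k t) t

namespace LaxFlow

variable {A B : Matrix (Fin (2 * m + 2)) (Fin (2 * m + 2)) ℂ} {q r q₀ r₀ : ℂ}
  {x y : ℤ → ℝ → Fin (2 * m + 2) → ℂ} {t : ℝ}

/-- The time derivative of `F`. Only the two extreme columns of `Φₙ` and the first column of `Ψₙ`
contribute, apart from the trace of `½ B`. -/
lemma hasDerivAt_casoratian (E : LaxFlow A B q r q₀ r₀ x y t) (hA : A.det ≠ 0) :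
    HasDerivAt (fun τ => casoratian (fun k => x k τ) fun k => y k τ)
      (A.det⁻¹ * bracket (fun k => x k t) (fun k => y k t)
          (x (2 * m + 4) t + q • y (2 * m + 3) t) (y (2 * m + 1) t) -
        A.det * bracket (fun k => x k t) (fun k => y k t) (x (-2) t) (y (-1) t + r • x 0 t) -
        2⁻¹ * (B.trace * casoratian (fun k => x k t) fun k => y k t)) t := by
  set γ := r * q₀ - q * r₀ with hγ
  let c : Fin (2 * m + 2) → ℝ → Fin (2 * m + 2) → ℂ := fun j =>
    if (j : ℕ) < m + 1 then x (2 * (j : ℕ) + 1) else y (2 * (j : ℕ) - 2 * m - 2)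
  have hc1 : ∀ j : Fin (2 * m + 2), (j : ℕ) < m + 1 → c j = x (2 * (j : ℕ) + 1) :=
    fun j h => if_pos h
  have hc2 : ∀ j : Fin (2 * m + 2), ¬ (j : ℕ) < m + 1 → c j = y (2 * (j : ℕ) - 2 * m - 2) :=
    fun j h => if_neg h
  have hcas : ∀ τ, casoratian (fun k => x k τ) (fun k => y k τ) = colDet fun j => c j τ := by
    intro τ
    unfold casoratian
    congr 1
    ext j : 1
    by_cases h : (j : ℕ) < m + 1
    · rw [if_pos h, hc1 j h]
    · rw [if_neg h, hc2 j h]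
  let e : Fin (2 * m + 2) → Fin (2 * m + 2) → ℂ := fun j =>
    if (j : ℕ) < m + 1 then
      (x (2 * (j : ℕ) + 3) t + q • y (2 * (j : ℕ) + 2) t) - x (2 * (j : ℕ) - 1) t +
        q₀ • y (2 * (j : ℕ)) t + (γ / 2) • c j t
    else r₀ • x (2 * (j : ℕ) - 2 * m - 1) t + r • x (2 * (j : ℕ) - 2 * m - 3) t +
      (-(γ / 2)) • c j t
  -- `e j` is the derivative of the column `c j` plus `½ B (c j)`; most of its terms are multiples
  -- of other columns.
  have hder := hasDerivAt_colDet_sub_mulVec (c := c) (e := e) (t := t) B (by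
    intro j
    by_cases h : (j : ℕ) < m + 1
    · simp only [e, if_pos h, hc1 j h]
      convert E.deriv_x (2 * (j : ℕ) + 1) using 1
      rw [E.hBx, show (2 * (j : ℕ) + 1 + 2 : ℤ) = 2 * (j : ℕ) + 3 by ring,
        show (2 * (j : ℕ) + 1 - 2 : ℤ) = 2 * (j : ℕ) - 1 by ring,
        show (2 * (j : ℕ) + 1 + 1 : ℤ) = 2 * (j : ℕ) + 2 by ring,
        show (2 * (j : ℕ) + 1 - 1 : ℤ) = 2 * (j : ℕ) by ring]
      module
    · simp only [e, if_neg h, hc2 j h]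
      convert E.deriv_y (2 * (j : ℕ) - 2 * m - 2) using 1
      rw [E.hBy, show (2 * (j : ℕ) - 2 * m - 2 + 1 : ℤ) = 2 * (j : ℕ) - 2 * m - 1 by ring,
        show (2 * (j : ℕ) - 2 * m - 2 - 1 : ℤ) = 2 * (j : ℕ) - 2 * m - 3 by ring]
      module)
  obtain ⟨jm, hjm⟩ : ∃ j : Fin (2 * m + 2), (j : ℕ) = m := ⟨⟨m, by omega⟩, rfl⟩
  obtain ⟨j₁, hj₁⟩ : ∃ j : Fin (2 * m + 2), (j : ℕ) = m + 1 := ⟨⟨m + 1, by omega⟩, rfl⟩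
  -- Only the columns `0`, `m` and `m + 1` contribute; the multiples `± γ / 2` cancel in the sum.
  have hsum : ∀ j, colDet (Function.update (fun j => c j t) j (e j)) =
      (if j = jm then colDet (Function.update (fun j => c j t) jm
        (x (2 * m + 3) t + q • y (2 * m + 2) t)) else 0) -
      (if j = 0 then colDet (Function.update (fun j => c j t) 0 (x (-1) t)) else 0) +
      (if j = j₁ then
        r * colDet (Function.update (fun j => c j t) j₁ (x (-1) t)) else 0) +
      (if (j : ℕ) < m + 1 then γ / 2 else -(γ / 2)) * colDet fun j => c j t := by
    intro j
    by_cases h : (j : ℕ) < m + 1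
    · have h1 : colDet (Function.update (fun j => c j t) j
          (x (2 * (j : ℕ) + 3) t + q • y (2 * (j : ℕ) + 2) t)) =
          if j = jm then colDet (Function.update (fun j => c j t) jm
            (x (2 * m + 3) t + q • y (2 * m + 2) t)) else 0 := by
        split_ifs with hj
        · rw [hj, hjm]
        · have hj' : (j : ℕ) ≠ m := fun h => hj (Fin.ext (by omega))
          rw [colDet_update_add, colDet_update_smul,
            colDet_update_eq_zero ⟨j + 1, by omega⟩ (fun h => by simp [Fin.ext_iff] at h)
              (by rw [hc1 _ (by dsimp only; omega)]; congr 1),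
            colDet_update_eq_zero ⟨j + m + 2, by omega⟩
              (fun h => by simp [Fin.ext_iff] at h; omega)
              (by rw [hc2 _ (by dsimp only; omega)]; congr 1; push_cast; ring)]
          ring
      have h2 : colDet (Function.update (fun j => c j t) j (x (2 * (j : ℕ) - 1) t)) =
          if j = 0 then colDet (Function.update (fun j => c j t) 0 (x (-1) t)) else 0 := by
        split_ifs with hj
        · subst hj; rfl
        · have hj' : (j : ℕ) ≠ 0 := fun h => hj (Fin.ext h)
          exact colDet_update_eq_zero ⟨j - 1, by omega⟩
            (fun h => by simp [Fin.ext_iff] at h; omega)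
            (by rw [hc1 _ (by dsimp only; omega)]; congr 1; dsimp only; omega)
      have h3 : colDet (Function.update (fun j => c j t) j (y (2 * (j : ℕ)) t)) = 0 :=
        colDet_update_eq_zero ⟨j + m + 1, by omega⟩
          (fun h => by simp [Fin.ext_iff] at h; omega)
          (by rw [hc2 _ (by dsimp only; omega)]; congr 1; push_cast; ring)
      have h4 : j ≠ j₁ := by rintro rfl; omega
      simp only [e, if_pos h]
      rw [colDet_update_add, colDet_update_add, colDet_update_sub, h1, h2, colDet_update_smul, h3,
        colDet_update_smul, Function.update_eq_self j (fun j => c j t), if_neg h4]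
      ring
    · have h1 : colDet (Function.update (fun j => c j t) j (x (2 * (j : ℕ) - 2 * m - 3) t)) =
          if j = j₁ then
            colDet (Function.update (fun j => c j t) j₁ (x (-1) t)) else 0 := by
        split_ifs with hj
        · rw [hj, hj₁]; congr 3; push_cast; ring
        · have hj' : (j : ℕ) ≠ m + 1 := fun h => hj (Fin.ext (by omega))
          exact colDet_update_eq_zero ⟨j - (m + 2), by omega⟩
            (fun h => by simp [Fin.ext_iff] at h; omega)
            (by rw [hc1 _ (by dsimp only; omega)]; congr 1; dsimp only; omega)
      have h2 : colDet (Function.update (fun j => c j t) j (x (2 * (j : ℕ) - 2 * m - 1) t)) = 0 :=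
        colDet_update_eq_zero ⟨j - (m + 1), by omega⟩
          (fun h => by simp [Fin.ext_iff] at h; omega)
          (by rw [hc1 _ (by dsimp only; omega)]; congr 1; dsimp only; omega)
      have h3 : j ≠ jm := by rintro rfl; omega
      have h4 : j ≠ 0 := by rintro rfl; simp at h
      simp only [e, if_neg h]
      rw [colDet_update_add, colDet_update_add, colDet_update_smul, colDet_update_smul, h1, h2,
        colDet_update_smul, Function.update_eq_self j (fun j => c j t), if_neg h3, if_neg h4]
      split_ifs <;> ring
  have hU : colDet (Function.update (fun j => c j t) jm
      (x (2 * m + 3) t + q • y (2 * m + 2) t)) = A.det⁻¹ *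
      bracket (fun k => x k t) (fun k => y k t)
          (x (2 * m + 4) t + q • y (2 * m + 3) t) (y (2 * m + 1) t) := by
    rw [eq_inv_mul_iff_mul_eq₀ hA, ← colDet_mulVec, ← colDet_eq_bracket_of_mid_last]
    congr 1
    ext j : 1
    by_cases hj : j = jm
    · rw [hj, Function.update_self, if_neg (by omega), if_pos hjm, Matrix.mulVec_add,
        Matrix.mulVec_smul, E.hx, E.hy, show (2 * m + 3 + 1 : ℤ) = 2 * m + 4 by ring,
        show (2 * m + 2 + 1 : ℤ) = 2 * m + 3 by ring]
    · have hj' : (j : ℕ) ≠ m := fun h => hj (Fin.ext (by omega))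
      rw [Function.update_of_ne hj]
      by_cases h : (j : ℕ) < m
      · rw [if_pos h, hc1 j (by omega), E.hx]; congr 1
      · rw [if_neg h, if_neg hj', hc2 j (by omega), E.hy]
        split_ifs <;> (congr 1; omega)
  have hL : colDet (Function.update (fun j => c j t) 0 (x (-1) t)) = A.det *
      bracket (fun k => x k t) (fun k => y k t) (x (-2) t) (y (-1) t) := by
    rw [bracket, ← colDet_mulVec]
    congr 1
    ext j : 1
    by_cases hj : j = 0
    · rw [hj, Function.update_self, if_pos (by simp), E.hx]; rfl
    · have hj' : (j : ℕ) ≠ 0 := fun h => hj (Fin.ext h)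
      rw [Function.update_of_ne hj, if_neg hj']
      by_cases h : (j : ℕ) < m + 1
      · rw [if_pos h, hc1 j h, E.hx]
      · rw [if_neg h, hc2 j h]
        split_ifs <;> (rw [E.hy]; congr 1; omega)
  have hL' : colDet (Function.update (fun j => c j t) j₁ (x (-1) t)) = A.det *
      bracket (fun k => x k t) (fun k => y k t) (x 0 t) (x (-2) t) := by
    rw [bracket, ← colDet_mulVec]
    congr 1
    ext j : 1
    by_cases hj : j = j₁
    · rw [hj, Function.update_self, if_neg (by omega), if_neg (by omega), if_pos hj₁, E.hx]; rfl
    · have hj' : (j : ℕ) ≠ m + 1 := fun h => hj (Fin.ext (by omega))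
      rw [Function.update_of_ne hj]
      by_cases h : (j : ℕ) < m + 1
      · rw [hc1 j h]
        split_ifs with h0
        · rw [E.hx]; congr 1; omega
        · rw [E.hx]
      · rw [if_neg (by omega), if_neg h, if_neg hj', hc2 j h, E.hy]
        congr 1; omega
  simp only [hcas]
  convert hder using 1
  rw [Finset.sum_congr rfl fun j _ => hsum j]
  simp only [Finset.sum_add_distrib, Finset.sum_sub_distrib, Finset.sum_ite_eq', Finset.mem_univ,
    if_true, ← Finset.sum_mul, sum_ite_lt_half, hU, hL, hL', bracket_add_right, bracket_smul_right,
    bracket_swap _ _ (x 0 t)]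
  ring

/-- The time derivative of `G`, whose column `x₂ₘ₊₂ + Q y₂ₘ₊₁` also depends on time through the
potential `Q`; `q₁` is the potential at `n + 1`. -/
lemma hasDerivAt_bracket (E : LaxFlow A B q r q₀ r₀ x y t) {Q : ℝ → ℂ} {q₁ : ℂ} (hQ : Q t = q)
    (hQ' : HasDerivAt Q ((1 - q * r) * (q₁ - q₀)) t) :
    HasDerivAt (fun τ => bracket (fun k => x k τ) (fun k => y k τ) (x 0 τ)
        (x (2 * m + 2) τ + Q τ • y (2 * m + 1) τ))
      (bracket (fun k => x k t) (fun k => y k t) (x 0 t)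
          (x (2 * m + 4) t + q • y (2 * m + 3) t + ((1 - q * r) * q₁) • y (2 * m + 1) t) -
        bracket (fun k => x k t) (fun k => y k t) (x (-2) t - q₀ • (y (-1) t + r • x 0 t))
          (x (2 * m + 2) t + q • y (2 * m + 1) t) -
        2⁻¹ * (B.trace * bracket (fun k => x k t) (fun k => y k t) (x 0 t)
          (x (2 * m + 2) t + q • y (2 * m + 1) t))) t := by
  set γ := r * q₀ - q * r₀ with hγ
  obtain ⟨j₁, hj₁⟩ : ∃ j : Fin (2 * m + 2), (j : ℕ) = m + 1 := ⟨⟨m + 1, by omega⟩, rfl⟩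
  let a : ℝ → Fin (2 * m + 2) → ℂ := fun τ => x (2 * m + 2) τ + Q τ • y (2 * m + 1) τ
  have hat : a t = x (2 * m + 2) t + q • y (2 * m + 1) t := by simp only [a, hQ]
  let c : Fin (2 * m + 2) → ℝ → Fin (2 * m + 2) → ℂ := fun j =>
    if (j : ℕ) < m + 1 then x (2 * (j : ℕ)) else if (j : ℕ) = m + 1 then a
    else y (2 * (j : ℕ) - 2 * m - 3)
  have hc1 : ∀ j : Fin (2 * m + 2), (j : ℕ) < m + 1 → c j = x (2 * (j : ℕ)) :=
    fun j h => if_pos h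
  have hc2 : ∀ j : Fin (2 * m + 2), (j : ℕ) = m + 1 → c j = a := fun j h => by
    simp only [c, h, lt_irrefl, if_false, if_true]
  have hc3 : ∀ j : Fin (2 * m + 2), m + 1 < (j : ℕ) → c j = y (2 * (j : ℕ) - 2 * m - 3) :=
    fun j h => by
      simp only [c]; rw [if_neg (by omega), if_neg (by omega)]
  have hbr : ∀ τ u v, bracket (fun k => x k τ) (fun k => y k τ) u v =
      colDet (Function.update (Function.update (fun j => c j τ) 0 u) j₁ v) := by
    intro τ u v
    have h := bracket_eq_update (fun k => x k τ) (fun k => y k τ) u v (fun j => c j τ)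
      (fun j _ h => by rw [hc1 j h]) (fun j h => by rw [hc3 j h])
    rwa [show (⟨m + 1, by omega⟩ : Fin (2 * m + 2)) = j₁ from Fin.ext hj₁.symm] at h
  have h01 : (0 : Fin (2 * m + 2)) ≠ j₁ := by rintro rfl; simp at hj₁
  have hc0 : ∀ τ, x 0 τ = c 0 τ := fun τ => by rw [hc1 0 (by simp)]; simp
  have hbr1 : ∀ u, bracket (fun k => x k t) (fun k => y k t) u (a t) =
      colDet (Function.update (fun j => c j t) 0 u) := by
    intro u
    rw [hbr, Function.update_comm h01, ← hc2 j₁ hj₁, Function.update_eq_self j₁ (fun j => c j t)]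
  have hbr2 : ∀ τ v, bracket (fun k => x k τ) (fun k => y k τ) (x 0 τ) v =
      colDet (Function.update (fun j => c j τ) j₁ v) := by
    intro τ v
    rw [hbr, hc0, Function.update_eq_self 0 (fun j => c j τ)]
  have hG : ∀ τ, bracket (fun k => x k τ) (fun k => y k τ) (x 0 τ) (a τ) =
      colDet fun j => c j τ := by
    intro τ
    rw [hbr2, ← hc2 j₁ hj₁, Function.update_eq_self j₁ (fun j => c j τ)]
  let z : Fin (2 * m + 2) → ℂ :=
    x (2 * m + 4) t + q • y (2 * m + 3) t + ((1 - q * r) * q₁) • y (2 * m + 1) t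
  let e : Fin (2 * m + 2) → Fin (2 * m + 2) → ℂ := fun j =>
    if (j : ℕ) < m + 1 then
      (x (2 * (j : ℕ) + 2) t + q • y (2 * (j : ℕ) + 1) t) +
        (q₀ • y (2 * (j : ℕ) - 1) t - x (2 * (j : ℕ) - 2) t) + (γ / 2) • c j t
    else if (j : ℕ) = m + 1 then
      z + (q * r - 1) • x (2 * m) t + (r * q₀) • a t + (-(γ / 2)) • c j t
    else r₀ • x (2 * (j : ℕ) - 2 * m - 2) t + r • x (2 * (j : ℕ) - 2 * m - 4) t +
      (-(γ / 2)) • c j t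
  -- In the column `a`, the terms `q₀ y₂ₘ₊₁` and `r₀ x₂ₘ₊₂` combine with `γ = r q₀ - q r₀` to
  -- `(r q₀ - γ / 2) a`.
  have hder := hasDerivAt_colDet_sub_mulVec (c := c) (e := e) (t := t) B (by
    intro j
    rcases lt_trichotomy (j : ℕ) (m + 1) with h | h | h
    · simp only [e, if_pos h, hc1 j h]
      convert E.deriv_x (2 * (j : ℕ)) using 1
      rw [E.hBx]
      module
    · simp only [e, hc2 j h, h, lt_irrefl, if_false, if_true]
      refine ((E.deriv_x (2 * m + 2)).add (hQ'.smul (E.deriv_y (2 * m + 1)))).congr_deriv ?_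
      rw [hat, Matrix.mulVec_add, Matrix.mulVec_smul, E.hBx, E.hBy, hQ,
        show (2 * m + 2 + 2 : ℤ) = 2 * m + 4 by ring, show (2 * m + 2 - 2 : ℤ) = 2 * m by ring,
        show (2 * m + 2 + 1 : ℤ) = 2 * m + 3 by ring, show (2 * m + 2 - 1 : ℤ) = 2 * m + 1 by ring,
        show (2 * m + 1 + 1 : ℤ) = 2 * m + 2 by ring, show (2 * m + 1 - 1 : ℤ) = 2 * m by ring,
        show (2 * m + 1 + 2 : ℤ) = 2 * m + 3 by ring]
      simp only [z, hγ]
      module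
    · simp only [e, if_neg h.not_gt, if_neg h.ne', hc3 j h]
      convert E.deriv_y (2 * (j : ℕ) - 2 * m - 3) using 1
      rw [E.hBy, show (2 * (j : ℕ) - 2 * m - 3 + 1 : ℤ) = 2 * (j : ℕ) - 2 * m - 2 by ring,
        show (2 * (j : ℕ) - 2 * m - 3 - 1 : ℤ) = 2 * (j : ℕ) - 2 * m - 4 by ring]
      module)
  have hsum : ∀ j, colDet (Function.update (fun j => c j t) j (e j)) =
      (if j = 0 then colDet (Function.update (fun j => c j t) 0 (q₀ • y (-1) t - x (-2) t))
        else 0) +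
      (if j = j₁ then colDet (Function.update (fun j => c j t) j₁ z) +
        r * q₀ * colDet (fun j => c j t) else 0) +
      (if (j : ℕ) < m + 1 then γ / 2 else -(γ / 2)) * colDet fun j => c j t := by
    intro j
    rcases lt_trichotomy (j : ℕ) (m + 1) with h | h | h
    · have h1 : colDet (Function.update (fun j => c j t) j
          (x (2 * (j : ℕ) + 2) t + q • y (2 * (j : ℕ) + 1) t)) = 0 := by
        -- For `j = m` the vector is the column `a` itself.
        by_cases hj : (j : ℕ) = m
        · exact colDet_update_eq_zero j₁ (by rintro rfl; omega) (by rw [hc2 j₁ hj₁, hat, hj])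
        · rw [colDet_update_add, colDet_update_smul,
            colDet_update_eq_zero ⟨j + 1, by omega⟩ (fun h => by simp [Fin.ext_iff] at h)
              (by rw [hc1 _ (by dsimp only; omega)]; congr 1),
            colDet_update_eq_zero ⟨j + m + 2, by omega⟩
              (fun h => by simp [Fin.ext_iff] at h; omega)
              (by rw [hc3 _ (by dsimp only; omega)]; congr 1; push_cast; ring)]
          ring
      have h2 : colDet (Function.update (fun j => c j t) j
          (q₀ • y (2 * (j : ℕ) - 1) t - x (2 * (j : ℕ) - 2) t)) =
          if j = 0 then colDet (Function.update (fun j => c j t) 0 (q₀ • y (-1) t - x (-2) t))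
            else 0 := by
        split_ifs with hj
        · subst hj; rfl
        · have hj' : (j : ℕ) ≠ 0 := fun h => hj (Fin.ext h)
          rw [colDet_update_sub, colDet_update_smul,
            colDet_update_eq_zero ⟨j + m + 1, by omega⟩
              (fun h => by simp [Fin.ext_iff] at h; omega)
              (by rw [hc3 _ (by dsimp only; omega)]; congr 1; push_cast; ring),
            colDet_update_eq_zero ⟨j - 1, by omega⟩
              (fun h => by simp [Fin.ext_iff] at h; omega)
              (by rw [hc1 _ (by dsimp only; omega)]; congr 1; dsimp only; omega)]
          ring
      have h4 : j ≠ j₁ := by rintro rfl; omega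
      simp only [e, if_pos h]
      rw [colDet_update_add, colDet_update_add, h1, h2, colDet_update_smul,
        Function.update_eq_self j (fun j => c j t), if_neg h4]
      ring
    · obtain rfl : j = j₁ := Fin.ext (by omega)
      have h1 : colDet (Function.update (fun j' => c j' t) j (x (2 * m) t)) = 0 :=
        colDet_update_eq_zero ⟨m, by omega⟩ (fun h' => by simp [Fin.ext_iff] at h'; omega)
          (by rw [hc1 _ (by dsimp only; omega)])
      have h2 : colDet (Function.update (fun j' => c j' t) j (a t)) = colDet fun j => c j t := by
        rw [← hc2 j h, Function.update_eq_self j (fun j => c j t)]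
      simp only [e, if_neg h.not_lt, if_pos h]
      rw [colDet_update_add, colDet_update_add, colDet_update_add, colDet_update_smul,
        colDet_update_smul, colDet_update_smul, h1, h2,
        Function.update_eq_self j (fun j => c j t), if_neg h01.symm, if_true]
      ring
    · have h1 : colDet (Function.update (fun j => c j t) j (x (2 * (j : ℕ) - 2 * m - 2) t)) = 0 :=
        colDet_update_eq_zero ⟨j - (m + 1), by omega⟩
          (fun h => by simp [Fin.ext_iff] at h; omega)
          (by rw [hc1 _ (by dsimp only; omega)]; congr 1; dsimp only; omega)
      have h2 : colDet (Function.update (fun j => c j t) j (x (2 * (j : ℕ) - 2 * m - 4) t)) = 0 :=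
        colDet_update_eq_zero ⟨j - (m + 2), by omega⟩
          (fun h => by simp [Fin.ext_iff] at h; omega)
          (by rw [hc1 _ (by dsimp only; omega)]; congr 1; dsimp only; omega)
      have h3 : j ≠ j₁ := by rintro rfl; omega
      have h4 : j ≠ 0 := by rintro rfl; simp at h
      simp only [e, if_neg h.not_gt, if_neg h.ne']
      rw [colDet_update_add, colDet_update_add, colDet_update_smul, colDet_update_smul, h1, h2,
        colDet_update_smul, Function.update_eq_self j (fun j => c j t), if_neg h3, if_neg h4]
      ring
  rw [← hat]
  simp only [show ∀ τ, x (2 * m + 2) τ + Q τ • y (2 * m + 1) τ = a τ from fun _ => rfl, hG]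
  convert hder using 1
  rw [Finset.sum_congr rfl fun j _ => hsum j]
  simp only [Finset.sum_add_distrib, Finset.sum_ite_eq', Finset.mem_univ,
    if_true, ← Finset.sum_mul, sum_ite_lt_half]
  rw [← hbr1, ← hbr2]
  simp only [bracket_sub_left, bracket_smul_left, bracket_add_left, hG, z]
  ring

end LaxFlow

end LaxFlow

/-! ### The sequences `Aᵏ v` and the Lax equations -/

section Orbit

variable {N : ℕ}

/-- The sequence of vectors `Aᵏ v`, `k ∈ ℤ`. -/
noncomputable def orbit (A : Matrix (Fin N) (Fin N) ℂ) (v : Fin N → ℂ) (k : ℤ) : Fin N → ℂ :=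
  A ^ k *ᵥ v

variable {A : Matrix (Fin N) (Fin N) ℂ} (v : Fin N → ℂ)

lemma orbit_zero : orbit A v 0 = v := by simp [orbit]

lemma pow_mulVec_eq_orbit {k : ℕ} {l : ℤ} (h : (k : ℤ) = l) : A ^ k *ᵥ v = orbit A v l := by
  rw [orbit, ← h, zpow_natCast]

lemma mulVec_orbit (hA : IsUnit A.det) (k : ℤ) : A *ᵥ orbit A v k = orbit A v (k + 1) := by
  rw [orbit, orbit, Matrix.mulVec_mulVec, add_comm, Matrix.zpow_one_add hA]

lemma orbit_inv (hA : IsUnit A.det) (k : ℤ) : orbit A⁻¹ v k = orbit A v (-k) := by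
  rw [orbit, orbit, Matrix.inv_zpow' hA]

lemma orbit_add (k : ℤ) (u v : Fin N → ℂ) : orbit A (u + v) k = orbit A u k + orbit A v k :=
  Matrix.mulVec_add _ _ _

lemma orbit_sub (k : ℤ) (u v : Fin N → ℂ) : orbit A (u - v) k = orbit A u k - orbit A v k :=
  Matrix.mulVec_sub _ _ _

lemma orbit_smul (k : ℤ) (a : ℂ) : orbit A (a • v) k = a • orbit A v k :=
  Matrix.mulVec_smul _ _ _

lemma orbit_orbit (hA : IsUnit A.det) {k l i : ℤ} (h : k + l = i) :
    orbit A (orbit A v l) k = orbit A v i := by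
  rw [orbit, orbit, orbit, Matrix.mulVec_mulVec, ← Matrix.zpow_add hA, h]

lemma hasDerivAt_mulVec (M : Matrix (Fin N) (Fin N) ℂ) {f : ℝ → Fin N → ℂ} {f' : Fin N → ℂ}
    {t : ℝ} (h : HasDerivAt f f' t) : HasDerivAt (fun τ => M *ᵥ f τ) (M *ᵥ f') t :=
  ((M.mulVecLin.restrictScalars ℝ).toContinuousLinearMap.hasFDerivAt (x := f t)).comp_hasDerivAt t h

end Orbit

section Lax

variable {N : ℕ} {q r s : ℤ → ℝ → ℂ} {A : Matrix (Fin N) (Fin N) ℂ} {Φ Ψ : ℤ → ℝ → Fin N → ℂ}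

/-- The Lax equations, written for the two components `Φ` and `Ψ` separately. -/
lemma solvesLax_iff : SolvesLax q r s A Φ Ψ ↔ ∀ n t,
    (Φ (n + 1) t = (s n t)⁻¹ • (A *ᵥ Φ n t + q n t • Ψ n t) ∧
      Ψ (n + 1) t = (s n t)⁻¹ • (r n t • Φ n t + A⁻¹ *ᵥ Ψ n t)) ∧
    (HasDerivAt (Φ n) ((2 : ℂ)⁻¹ • (A ^ 2 *ᵥ Φ n t - A⁻¹ ^ 2 *ᵥ Φ n t +
        (r n t * q (n - 1) t - q n t * r (n - 1) t) • Φ n t +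
        ((2 * q n t) • (A *ᵥ Ψ n t) + (2 * q (n - 1) t) • (A⁻¹ *ᵥ Ψ n t)))) t ∧
      HasDerivAt (Ψ n) ((2 : ℂ)⁻¹ • ((2 * r (n - 1) t) • (A *ᵥ Φ n t) +
        (2 * r n t) • (A⁻¹ *ᵥ Φ n t) + (A⁻¹ ^ 2 *ᵥ Ψ n t - A ^ 2 *ᵥ Ψ n t -
        (r n t * q (n - 1) t - q n t * r (n - 1) t) • Ψ n t))) t) := by
  have hsum : ∀ {a b c d : Fin N → ℂ}, Sum.elim a b = Sum.elim c d ↔ a = c ∧ b = d := by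
    intro a b c d
    simp [funext_iff]
  have hcomp : ∀ a b : Fin N → ℂ, Sum.elim a b ∘ Sum.inl = a ∧ Sum.elim a b ∘ Sum.inr = b :=
    fun a b => ⟨rfl, rfl⟩
  unfold SolvesLax
  refine forall_congr' fun n => forall_congr' fun t => and_congr ?_ ?_
  · rw [laxM, Matrix.smul_mulVec, Matrix.fromBlocks_mulVec, (hcomp _ _).1, (hcomp _ _).2,
      Matrix.smul_mulVec, Matrix.smul_mulVec, Matrix.one_mulVec, Matrix.one_mulVec, ← hsum]
    refine Eq.congr_right ?_
    ext i
    rcases i with i | i <;> simp [mul_add]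
  · rw [laxN, Matrix.fromBlocks_mulVec, (hcomp _ _).1, (hcomp _ _).2, hasDerivAt_pi,
      hasDerivAt_pi, hasDerivAt_pi]
    simp only [Sum.forall, Sum.elim_inl, Sum.elim_inr, Pi.smul_apply, Matrix.add_mulVec,
      Matrix.sub_mulVec, Matrix.smul_mulVec, Matrix.one_mulVec]

/-- The Lax pair is invariant under exchanging `Φ` with `Ψ`, `q` with `r` and `A` with `A⁻¹`. -/
lemma SolvesLax.swap (h : SolvesLax q r s A Φ Ψ) (hA : A.det ≠ 0) :
    SolvesLax r q s A⁻¹ Ψ Φ := by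
  rw [solvesLax_iff] at h ⊢
  intro n t
  obtain ⟨⟨h1, h2⟩, h3, h4⟩ := h n t
  rw [Matrix.nonsing_inv_nonsing_inv A (isUnit_iff_ne_zero.2 hA)]
  refine ⟨⟨by rw [h2, add_comm], by rw [h1, add_comm]⟩, h4.congr_deriv ?_, h3.congr_deriv ?_⟩
  · module
  · module

lemma SolvesLax.conj (h : SolvesLax q r s A Φ Ψ) {P J : Matrix (Fin N) (Fin N) ℂ}
    (hJ : J * P = P * A) (hJ' : J⁻¹ * P = P * A⁻¹) :
    SolvesLax q r s J (fun n t => P *ᵥ Φ n t) (fun n t => P *ᵥ Ψ n t) := by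
  have h1 : ∀ v, J *ᵥ P *ᵥ v = P *ᵥ A *ᵥ v := fun v => by
    rw [Matrix.mulVec_mulVec, hJ, Matrix.mulVec_mulVec]
  have h2 : ∀ v, J⁻¹ *ᵥ P *ᵥ v = P *ᵥ A⁻¹ *ᵥ v := fun v => by
    rw [Matrix.mulVec_mulVec, hJ', Matrix.mulVec_mulVec]
  rw [solvesLax_iff] at h ⊢
  intro n t
  obtain ⟨⟨h3, h4⟩, h5, h6⟩ := h n t
  simp only [pow_two, ← Matrix.mulVec_mulVec, h1, h2] at h5 h6 ⊢
  refine ⟨⟨?_, ?_⟩, (hasDerivAt_mulVec P h5).congr_deriv ?_,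
    (hasDerivAt_mulVec P h6).congr_deriv ?_⟩
  · rw [h3]; simp only [Matrix.mulVec_smul, Matrix.mulVec_add]
  · rw [h4]; simp only [Matrix.mulVec_smul, Matrix.mulVec_add]
  · simp only [Matrix.mulVec_smul, Matrix.mulVec_add, Matrix.mulVec_sub]
  · simp only [Matrix.mulVec_smul, Matrix.mulVec_add, Matrix.mulVec_sub]

end Lax

section Casoratians

variable {m : ℕ} {q r s : ℤ → ℝ → ℂ} {A : Matrix (Fin (2 * m + 2)) (Fin (2 * m + 2)) ℂ}
  {Φ Ψ : ℤ → ℝ → Fin (2 * m + 2) → ℂ}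

lemma SolvesLax.laxStep (h : SolvesLax q r s A Φ Ψ) (hA : A.det ≠ 0)
    (hα : ∀ (n : ℤ) (t : ℝ), 1 - q n t * r n t ≠ 0)
    (hs : ∀ (n : ℤ) (t : ℝ), s n t ^ 2 = 1 - q n t * r n t) {n n' : ℤ} (hn : n + 1 = n') (t : ℝ) :
    LaxStep (s n t) (q n t) (r n t) (orbit A (Φ n t)) (orbit A (Ψ n t)) (orbit A (Φ n' t))
      (orbit A (Ψ n' t)) := by
  have hA' := isUnit_iff_ne_zero.2 hA
  have hne : s n t ≠ 0 := fun h0 => hα n t (by rw [← hs, h0]; ring)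
  obtain ⟨⟨h1, h2⟩, -⟩ := solvesLax_iff.1 h n t
  subst hn
  have h3 : ∀ v, A *ᵥ v = orbit A v 1 := fun v => by simp [orbit]
  have h4 : ∀ v, A⁻¹ *ᵥ v = orbit A v (-1) := fun v => by rw [orbit, Matrix.zpow_neg_one]
  refine ⟨hne, hs n t, fun k => ?_, fun k => ?_⟩
  · rw [h1, orbit_smul, smul_inv_smul₀ hne, orbit_add, orbit_smul, h3, orbit_orbit _ hA' rfl]
  · rw [h2, orbit_smul, smul_inv_smul₀ hne, orbit_add, orbit_smul, h4, orbit_orbit _ hA' rfl]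
    rfl

lemma SolvesLax.laxFlow (h : SolvesLax q r s A Φ Ψ) (hA : A.det ≠ 0) (n : ℤ) (t : ℝ) :
    LaxFlow A (A ^ 2 - A⁻¹ ^ 2) (q n t) (r n t) (q (n - 1) t) (r (n - 1) t)
      (fun k τ => orbit A (Φ n τ) k) (fun k τ => orbit A (Ψ n τ) k) t := by
  have hA' := isUnit_iff_ne_zero.2 hA
  obtain ⟨-, h1, h2⟩ := solvesLax_iff.1 h n t
  have h3 : ∀ v, A *ᵥ v = orbit A v 1 := fun v => by simp [orbit]
  have h4 : ∀ v, A⁻¹ *ᵥ v = orbit A v (-1) := fun v => by rw [orbit, Matrix.zpow_neg_one]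
  have h5 : ∀ v, A ^ 2 *ᵥ v = orbit A v 2 := fun v => pow_mulVec_eq_orbit v rfl
  have h6 : ∀ v, A⁻¹ ^ 2 *ᵥ v = orbit A v (-2) := fun v => by
    rw [pow_mulVec_eq_orbit v (l := 2) rfl, orbit_inv _ hA']
  have hB : ∀ v k, (A ^ 2 - A⁻¹ ^ 2) *ᵥ orbit A v k = orbit A v (k + 2) - orbit A v (k - 2) := by
    intro v k
    rw [Matrix.sub_mulVec, h5, h6, orbit_orbit _ hA' (add_comm 2 k),
      orbit_orbit _ hA' (i := k - 2) (by ring)]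
  refine ⟨fun k => mulVec_orbit _ hA' k, fun k => mulVec_orbit _ hA' k, fun k => hB _ k,
    fun k => hB _ k, fun k => ?_, fun k => ?_⟩
  · refine (hasDerivAt_mulVec (A ^ k) h1).congr_deriv ?_
    change orbit A _ k = _
    rw [h3, h4, h5, h6]
    simp only [orbit_add, orbit_sub, orbit_smul]
    rw [orbit_orbit _ hA' rfl, orbit_orbit _ hA' (i := k - 2) rfl, orbit_orbit _ hA' rfl,
      orbit_orbit _ hA' (i := k - 1) rfl]
    module
  · refine (hasDerivAt_mulVec (A ^ k) h2).congr_deriv ?_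
    change orbit A _ k = _
    rw [h3, h4, h5, h6]
    simp only [orbit_add, orbit_sub, orbit_smul]
    rw [orbit_orbit _ hA' rfl, orbit_orbit _ hA' (i := k - 1) rfl,
      orbit_orbit _ hA' (i := k - 2) rfl, orbit_orbit _ hA' rfl]
    module

variable (m s A Φ Ψ) in
lemma casoratianF_eq_orbit (n : ℤ) (t : ℝ) :
    casoratianF m s A Φ Ψ n t = s n t ^ (m + 1) * colDet fun j : Fin (2 * m + 2) =>
      if (j : ℕ) < m + 1 then orbit A (Φ (n + 1) t) (2 * (j : ℕ))
      else orbit A (Ψ n t) (2 * (j : ℕ) - 2 * m - 2) := by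
  unfold casoratianF
  congr 2
  ext j : 1
  split_ifs
  all_goals exact pow_mulVec_eq_orbit _ (by omega)

variable (m s A Φ Ψ) in
lemma casoratianG_eq_orbit (n : ℤ) (t : ℝ) :
    casoratianG m s A Φ Ψ n t = s n t ^ (m + 1) * colDet fun j : Fin (2 * m + 2) =>
      if (j : ℕ) = 0 then orbit A (Φ n t) 0
      else if (j : ℕ) < m + 2 then orbit A (Φ (n + 1) t) (2 * (j : ℕ) - 1)
      else orbit A (Ψ n t) (2 * (j : ℕ) - 2 * m - 3) := by
  unfold casoratianG
  congr 2
  ext j : 1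
  split_ifs
  · rw [orbit_zero]
  all_goals exact pow_mulVec_eq_orbit _ (by omega)

variable (m s A Φ Ψ) in
lemma casoratianH_eq_orbit (n : ℤ) (t : ℝ) :
    casoratianH m s A Φ Ψ n t = s n t ^ (m + 1) * colDet fun j : Fin (2 * m + 2) =>
      if (j : ℕ) < m then orbit A (Φ (n + 1) t) (2 * (j : ℕ) + 1)
      else if (j : ℕ) = m then orbit A (Ψ (n + 1) t) 0
      else orbit A (Ψ n t) (2 * (j : ℕ) - 2 * m - 1) := by
  unfold casoratianH
  congr 2
  ext j : 1
  split_ifs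
  · exact pow_mulVec_eq_orbit _ (by omega)
  · rw [orbit_zero]
  · exact pow_mulVec_eq_orbit _ (by omega)

end Casoratians

/-! ### The bilinear equations -/

section Reversal

variable {m : ℕ} {A : Matrix (Fin (2 * m + 2)) (Fin (2 * m + 2)) ℂ}

lemma pow_mulVec_orbit (hA : A.det ≠ 0) (v : Fin (2 * m + 2) → ℂ) {k l : ℤ}
    (h : 2 * m + 1 + k = l) : A ^ (2 * m + 1) *ᵥ orbit A v k = orbit A v l := by
  rw [pow_mulVec_eq_orbit _ (l := 2 * m + 1) (by push_cast; ring),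
    orbit_orbit _ (isUnit_iff_ne_zero.2 hA) h]

/-- Exchanging `A` with `A⁻¹` and `Φ` with `Ψ` reverses the order of the columns of `F`, up to a
factor `A²ᵐ⁺¹` in each column. -/
lemma casoratian_inv (hA : A.det ≠ 0) (φ ψ : Fin (2 * m + 2) → ℂ) :
    A.det ^ (2 * m + 1) * casoratian (orbit A⁻¹ ψ) (orbit A⁻¹ φ) =
      ((Equiv.Perm.sign (Fin.revPerm : Equiv.Perm (Fin (2 * m + 2))) : ℤ) : ℂ) *
        casoratian (orbit A φ) (orbit A ψ) := by
  have hA' := isUnit_iff_ne_zero.2 hA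
  rw [← Matrix.det_pow, casoratian, casoratian, ← colDet_mulVec, ← colDet_comp_perm]
  congr 1
  ext j : 1
  simp only [Fin.revPerm_apply, Fin.val_rev, orbit_inv _ hA']
  split_ifs
  · omega
  · exact pow_mulVec_orbit hA _ (by omega)
  · exact pow_mulVec_orbit hA _ (by omega)
  · omega

/-- The same exchange turns `G` into `H`, with the same factor. -/
lemma bracket_inv (hA : A.det ≠ 0) (φ ψ : Fin (2 * m + 2) → ℂ) (r : ℂ) :
    A.det ^ (2 * m + 1) * bracket (orbit A⁻¹ ψ) (orbit A⁻¹ φ) (orbit A⁻¹ ψ 0)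
        (orbit A⁻¹ ψ (2 * m + 2) + r • orbit A⁻¹ φ (2 * m + 1)) =
      ((Equiv.Perm.sign (Fin.revPerm : Equiv.Perm (Fin (2 * m + 2))) : ℤ) : ℂ) *
        bracket (orbit A φ) (orbit A ψ) (orbit A ψ (-1) + r • orbit A φ 0)
          (orbit A ψ (2 * m + 1)) := by
  have hA' := isUnit_iff_ne_zero.2 hA
  rw [← Matrix.det_pow, bracket, ← colDet_eq_bracket_of_mid_last, ← colDet_mulVec,
    ← colDet_comp_perm]
  congr 1
  ext j : 1
  simp only [Fin.revPerm_apply, Fin.val_rev, orbit_inv _ hA']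
  rcases Nat.eq_zero_or_pos (j : ℕ) with h0 | h0
  · rw [if_pos h0, if_neg (by omega), if_neg (by omega), if_neg (by omega)]
    exact pow_mulVec_orbit hA _ (by omega)
  rw [if_neg (by omega)]
  rcases lt_trichotomy (j : ℕ) (m + 1) with h | h | h
  · rw [if_pos h, if_neg (by omega), if_neg (by omega), if_pos (by omega)]
    exact pow_mulVec_orbit hA _ (by omega)
  · rw [if_neg (by omega), if_pos h, if_neg (by omega), if_pos (by omega), Matrix.mulVec_add,
      Matrix.mulVec_smul, pow_mulVec_orbit hA _ (l := -1) (by omega),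
      pow_mulVec_orbit hA _ (l := 0) (by omega)]
  · rw [if_neg (by omega), if_neg (by omega), if_pos (by omega)]
    exact pow_mulVec_orbit hA _ (by omega)

end Reversal

section Bilinear

variable {m : ℕ} {q r s : ℤ → ℝ → ℂ} {A : Matrix (Fin (2 * m + 2)) (Fin (2 * m + 2)) ℂ}
  {Φ Ψ : ℤ → ℝ → Fin (2 * m + 2) → ℂ}

lemma hirotaD_eq {F G : ℝ → ℂ} {F' G' : ℂ} {t : ℝ} (hF : HasDerivAt F F' t)
    (hG : HasDerivAt G G' t) : hirotaD G F t = G' * F t - G t * F' := by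
  rw [hirotaD, (hG.mul_const (F t)).deriv, (hF.const_mul (G t)).deriv]

variable (hα : ∀ (n : ℤ) (t : ℝ), 1 - q n t * r n t ≠ 0)
  (hs : ∀ (n : ℤ) (t : ℝ), s n t ^ 2 = 1 - q n t * r n t) (hA : A.det ≠ 0)
  (h : SolvesLax q r s A Φ Ψ) (n : ℤ) (t : ℝ)
include hα hs hA h

lemma casoratianF_eq : casoratianF m s A Φ Ψ n t =
    casoratian (orbit A (Φ n t)) (orbit A (Ψ n t)) := by
  rw [casoratianF_eq_orbit]
  exact (h.laxStep hA hα hs rfl t).quasiF_left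

lemma casoratianG_eq : casoratianG m s A Φ Ψ n t =
    bracket (orbit A (Φ n t)) (orbit A (Ψ n t)) (orbit A (Φ n t) 0)
      (orbit A (Φ n t) (2 * m + 2) + q n t • orbit A (Ψ n t) (2 * m + 1)) := by
  rw [casoratianG_eq_orbit]
  exact (h.laxStep hA hα hs rfl t).quasiG_left

lemma casoratianH_eq : casoratianH m s A Φ Ψ n t =
    bracket (orbit A (Φ n t)) (orbit A (Ψ n t))
      (orbit A (Ψ n t) (-1) + r n t • orbit A (Φ n t) 0) (orbit A (Ψ n t) (2 * m + 1)) := by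
  rw [casoratianH_eq_orbit]
  exact (h.laxStep hA hα hs rfl t).quasiH_left

lemma casoratianF_eq_lower : casoratianF m s A Φ Ψ n t =
    A.det * bracket (orbit A (Φ n t)) (orbit A (Ψ n t)) (orbit A (Φ n t) 0)
      (orbit A (Ψ n t) (-1) + r n t • orbit A (Φ n t) 0) := by
  have hA' := isUnit_iff_ne_zero.2 hA
  rw [casoratianF_eq hα hs hA h, casoratian_eq_lower (A := A) (mulVec_orbit _ hA')
    (mulVec_orbit _ hA'), bracket_add_right, bracket_smul_right, bracket_self]
  ring

lemma casoratianF_eq_upper : casoratianF m s A Φ Ψ n t =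
    A.det⁻¹ * bracket (orbit A (Φ n t)) (orbit A (Ψ n t))
      (orbit A (Φ n t) (2 * m + 2) + q n t • orbit A (Ψ n t) (2 * m + 1))
      (orbit A (Ψ n t) (2 * m + 1)) := by
  have hA' := isUnit_iff_ne_zero.2 hA
  rw [eq_inv_mul_iff_mul_eq₀ hA, casoratianF_eq hα hs hA h, casoratian_eq_upper
    (mulVec_orbit _ hA') (mulVec_orbit _ hA'), bracket_add_left, bracket_smul_left, bracket_self]
  ring

lemma casoratianF_pred : casoratianF m s A Φ Ψ (n - 1) t =
    (-1) ^ m * bracket (orbit A (Φ n t)) (orbit A (Ψ n t)) (orbit A (Φ n t) 0)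
      (orbit A (Ψ n t) (2 * m + 1)) := by
  rw [casoratianF_eq_orbit, sub_add_cancel]
  exact (h.laxStep hA hα hs (sub_add_cancel n 1) t).quasiF_right

lemma casoratianG_pred : casoratianG m s A Φ Ψ (n - 1) t =
    A.det * ((-1) ^ m * bracket (orbit A (Φ n t)) (orbit A (Ψ n t))
      (orbit A (Φ n t) (-2) - q (n - 1) t • orbit A (Ψ n t) (-1)) (orbit A (Φ n t) 0)) := by
  have hA' := isUnit_iff_ne_zero.2 hA
  rw [casoratianG_eq_orbit, sub_add_cancel]
  exact (h.laxStep hA hα hs (sub_add_cancel n 1) t).quasiG_right (mulVec_orbit _ hA')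
    (mulVec_orbit _ hA')

lemma casoratianF_succ : (1 - q n t * r n t) * casoratianF m s A Φ Ψ (n + 1) t =
    (-1) ^ m * bracket (orbit A (Φ n t)) (orbit A (Ψ n t))
      (orbit A (Φ n t) (2 * m + 2) + q n t • orbit A (Ψ n t) (2 * m + 1))
      (orbit A (Ψ n t) (-1) + r n t • orbit A (Φ n t) 0) := by
  rw [casoratianF_eq hα hs hA h, ← hs]
  exact (h.laxStep hA hα hs rfl t).casoratian_right

lemma casoratianG_succ : (1 - q n t * r n t) * casoratianG m s A Φ Ψ (n + 1) t =
    A.det⁻¹ * ((-1) ^ m * bracket (orbit A (Φ n t)) (orbit A (Ψ n t))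
      (orbit A (Φ n t) (2 * m + 2) + q n t • orbit A (Ψ n t) (2 * m + 1))
      (orbit A (Φ n t) (2 * m + 4) + q n t • orbit A (Ψ n t) (2 * m + 3) +
        ((1 - q n t * r n t) * q (n + 1) t) • orbit A (Ψ n t) (2 * m + 1))) := by
  have hA' := isUnit_iff_ne_zero.2 hA
  rw [casoratianG_eq hα hs hA h, ← hs, eq_inv_mul_iff_mul_eq₀ hA]
  exact (h.laxStep hA hα hs rfl t).bracket_right (mulVec_orbit _ hA') (mulVec_orbit _ hA') _

/-- The bilinear equation without time derivatives is a Plücker relation. -/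
lemma bilinear_algebraic : (1 - q n t * r n t) * casoratianF m s A Φ Ψ (n + 1) t *
      casoratianF m s A Φ Ψ (n - 1) t + casoratianG m s A Φ Ψ n t * casoratianH m s A Φ Ψ n t -
      casoratianF m s A Φ Ψ n t ^ 2 = 0 := by
  have hone : ((-1) ^ m * (-1) ^ m : ℂ) = 1 := by rw [← mul_pow]; simp
  rw [casoratianF_succ hα hs hA h, casoratianF_pred hα hs hA h, casoratianG_eq hα hs hA h,
    casoratianH_eq hα hs hA h, pow_two]
  nth_rw 1 [casoratianF_eq_lower hα hs hA h]
  rw [casoratianF_eq_upper hα hs hA h]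
  set x := orbit A (Φ n t)
  set y := orbit A (Ψ n t)
  have hp := bracket_plucker x y (x 0) (x (2 * m + 2) + q n t • y (2 * m + 1))
    (y (-1) + r n t • x 0) (y (2 * m + 1))
  have hd := mul_inv_cancel₀ hA
  linear_combination hp + bracket x y (x 0) (y (2 * m + 1)) *
    bracket x y (x (2 * m + 2) + q n t • y (2 * m + 1)) (y (-1) + r n t • x 0) * hone -
    bracket x y (x 0) (y (-1) + r n t • x 0) *
      bracket x y (x (2 * m + 2) + q n t • y (2 * m + 1)) (y (2 * m + 1)) * hd

/-- The bilinear evolution equation of `G` and `F`. -/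
lemma exists_hasDerivAt_casoratian (hq : HasDerivAt (q n)
      ((1 - q n t * r n t) * (q (n + 1) t - q (n - 1) t)) t) :
    ∃ F' G' : ℂ, HasDerivAt (casoratianF m s A Φ Ψ n) F' t ∧
      HasDerivAt (casoratianG m s A Φ Ψ n) G' t ∧
      G' * casoratianF m s A Φ Ψ n t - casoratianG m s A Φ Ψ n t * F' =
        (1 - q n t * r n t) *
          (casoratianG m s A Φ Ψ (n + 1) t * casoratianF m s A Φ Ψ (n - 1) t -
            casoratianG m s A Φ Ψ (n - 1) t * casoratianF m s A Φ Ψ (n + 1) t) := by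
  have E := h.laxFlow hA n t
  have hF : casoratianF m s A Φ Ψ n = fun τ =>
      casoratian (orbit A (Φ n τ)) (orbit A (Ψ n τ)) :=
    funext fun τ => casoratianF_eq hα hs hA h n τ
  have hG : casoratianG m s A Φ Ψ n = fun τ => bracket (orbit A (Φ n τ)) (orbit A (Ψ n τ))
      (orbit A (Φ n τ) 0) (orbit A (Φ n τ) (2 * m + 2) + q n τ • orbit A (Ψ n τ) (2 * m + 1)) :=
    funext fun τ => casoratianG_eq hα hs hA h n τ
  refine ⟨_, _, hF ▸ E.hasDerivAt_casoratian hA, hG ▸ E.hasDerivAt_bracket rfl hq, ?_⟩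
  have hF0 := casoratianF_eq hα hs hA h n t
  have hF1 := casoratianF_eq_lower hα hs hA h n t
  have hF2 := casoratianF_eq_upper hα hs hA h n t
  have hG0 := casoratianG_eq hα hs hA h n t
  have hFp := casoratianF_pred hα hs hA h n t
  have hGp := casoratianG_pred hα hs hA h n t
  have hFs := casoratianF_succ hα hs hA h n t
  have hGs := casoratianG_succ hα hs hA h n t
  have hone : ((-1) ^ m * (-1) ^ m : ℂ) = 1 := by rw [← mul_pow]; simp
  rw [show ∀ α G₁ F₀ G₀ F₁ : ℂ, α * (G₁ * F₀ - G₀ * F₁) = (α * G₁) * F₀ - G₀ * (α * F₁) from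
    fun _ _ _ _ _ => by ring, hGs, hFs, hFp, hGp]
  eta_reduce
  rw [← hF0]
  set x := orbit A (Φ n t)
  set y := orbit A (Ψ n t)
  set a := x (2 * m + 2) + q n t • y (2 * m + 1)
  set b := y (-1) + r n t • x 0 with hb
  set z := x (2 * m + 4) + q n t • y (2 * m + 3) +
    ((1 - q n t * r n t) * q (n + 1) t) • y (2 * m + 1) with hz
  set p := x (-2) - q (n - 1) t • b with hp
  have hzy : bracket x y (x (2 * m + 4) + q n t • y (2 * m + 3)) (y (2 * m + 1)) =
      bracket x y z (y (2 * m + 1)) := by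
    rw [hz, bracket_add_left _ _ (_ + _), bracket_smul_left, bracket_self]; ring
  have hpb : bracket x y (x (-2)) b = bracket x y p b := by
    rw [hp, bracket_sub_left, bracket_smul_left, bracket_self]; ring
  have hpx : bracket x y (x (-2) - q (n - 1) t • y (-1)) (x 0) = bracket x y p (x 0) := by
    simp only [hp, hb, bracket_sub_left, bracket_smul_left, bracket_add_left, bracket_self]; ring
  have h1 := bracket_plucker x y (x 0) z a (y (2 * m + 1))
  have h2 := bracket_plucker x y p (x 0) a b
  rw [bracket_swap x y z a] at h1
  rw [hzy, hpb, hpx, hG0]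
  -- The part of `G` with `z` meets `F = (det A)⁻¹ [a, y₂ₘ₊₁]`, the part with `p` meets
  -- `F = det A [x₀, b]`.
  linear_combination (-bracket x y p a) * hF1 + bracket x y (x 0) z * hF2 + A.det⁻¹ * h1 +
    A.det * h2 + (A.det * bracket x y p (x 0) * bracket x y a b -
      A.det⁻¹ * bracket x y a z * bracket x y (x 0) (y (2 * m + 1))) * hone

/-- The symmetry `(q, r, A, Φ, Ψ) ↦ (r, q, A⁻¹, Ψ, Φ)` preserves `F` and exchanges `G` with `H`, up
to a common constant factor. -/
lemma exists_inv_eq : ∃ κ : ℂ, ∀ n t,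
    casoratianF m s A Φ Ψ n t = κ * casoratianF m s A⁻¹ Ψ Φ n t ∧
      casoratianH m s A Φ Ψ n t = κ * casoratianG m s A⁻¹ Ψ Φ n t := by
  have hα' : ∀ (n : ℤ) (t : ℝ), 1 - r n t * q n t ≠ 0 := fun n t => by
    rw [mul_comm]; exact hα n t
  have hs' : ∀ (n : ℤ) (t : ℝ), s n t ^ 2 = 1 - r n t * q n t := fun n t => by
    rw [mul_comm]; exact hs n t
  have hA' : A⁻¹.det ≠ 0 := by
    rw [Matrix.det_nonsing_inv, Ring.inverse_eq_inv']; exact inv_ne_zero hA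
  have h' := h.swap hA
  set σ : ℂ := ((Equiv.Perm.sign (Fin.revPerm : Equiv.Perm (Fin (2 * m + 2))) : ℤ) : ℂ) with hσ
  have hσ2 : σ * σ = 1 := by
    rw [hσ, ← Int.cast_mul, ← Units.val_mul, Int.units_mul_self]; simp
  refine ⟨σ * A.det ^ (2 * m + 1), fun n t => ⟨?_, ?_⟩⟩
  · rw [casoratianF_eq hα hs hA h, casoratianF_eq hα' hs' hA' h', mul_assoc,
      casoratian_inv hA, ← hσ, ← mul_assoc, hσ2, one_mul]
  · rw [casoratianH_eq hα hs hA h, casoratianG_eq hα' hs' hA' h', mul_assoc,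
      bracket_inv hA, ← hσ, ← mul_assoc, hσ2, one_mul]

lemma solvesBilinearAt (hqr : SolvesCoupledAt q r n t) :
    SolvesBilinearAt q r (casoratianF m s A Φ Ψ) (casoratianG m s A Φ Ψ)
      (casoratianH m s A Φ Ψ) n t := by
  obtain ⟨F', G', hF', hG', hFG⟩ := exists_hasDerivAt_casoratian hα hs hA h n t hqr.1
  obtain ⟨κ, hκ⟩ := exists_inv_eq hα hs hA h
  have hA' : A⁻¹.det ≠ 0 := by
    rw [Matrix.det_nonsing_inv, Ring.inverse_eq_inv']; exact inv_ne_zero hA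
  obtain ⟨F₁, H₁, hF₁, hH₁, hFH⟩ := exists_hasDerivAt_casoratian (q := r) (r := q)
    (fun n t => by rw [mul_comm]; exact hα n t) (fun n t => by rw [mul_comm]; exact hs n t)
    hA' (h.swap hA) n t (by rw [mul_comm (r n t)]; exact hqr.2)
  have hF₂ := hF₁.const_mul κ
  have hH₂ := hH₁.const_mul κ
  rw [← show casoratianF m s A Φ Ψ n = _ from funext fun τ => (hκ n τ).1] at hF₂
  rw [← show casoratianH m s A Φ Ψ n = _ from funext fun τ => (hκ n τ).2] at hH₂
  refine ⟨⟨hF'.differentiableAt, hG'.differentiableAt, hH₂.differentiableAt⟩,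
    bilinear_algebraic hα hs hA h n t, ?_, ?_⟩
  · rw [hirotaD_eq hF' hG', hFG]
  · rw [hirotaD_eq hF₂ hH₂]
    simp only [(hκ _ _).1, (hκ _ _).2]
    linear_combination κ ^ 2 * hFH

end Bilinear

/-- Quotients of solutions of the bilinear system solve the coupled system. -/
lemma SolvesBilinearAt.solvesCoupledAt {q r F G H : ℤ → ℝ → ℂ} {n : ℤ} {t : ℝ}
    (h : SolvesBilinearAt q r F G H n t) (h₀ : F (n - 1) t ≠ 0) (h₁ : F n t ≠ 0)
    (h₂ : F (n + 1) t ≠ 0) :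
    SolvesCoupledAt (fun n t => G n t / F n t) (fun n t => H n t / F n t) n t := by
  obtain ⟨⟨hF, hG, hH⟩, h3, h4, h5⟩ := h
  rw [hirotaD_eq hF.hasDerivAt hG.hasDerivAt] at h4
  rw [hirotaD_eq hF.hasDerivAt hH.hasDerivAt] at h5
  have h6 : 1 - G n t / F n t * (H n t / F n t) =
      (1 - q n t * r n t) * F (n + 1) t * F (n - 1) t / F n t ^ 2 := by
    field_simp
    linear_combination -h3
  refine ⟨(hG.hasDerivAt.div hF.hasDerivAt h₁).congr_deriv ?_,
    (hH.hasDerivAt.div hF.hasDerivAt h₁).congr_deriv ?_⟩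
  · rw [h6, h4]
    field_simp
  · rw [h6, h5]
    field_simp

lemma casoratian_conj {m : ℕ} {s : ℤ → ℝ → ℂ}
    {A J P : Matrix (Fin (2 * m + 2)) (Fin (2 * m + 2)) ℂ}
    (hJ : J * P = P * A) (Φ Ψ : ℤ → ℝ → Fin (2 * m + 2) → ℂ) (n : ℤ) (t : ℝ) :
    casoratianF m s J (fun n t => P *ᵥ Φ n t) (fun n t => P *ᵥ Ψ n t) n t =
      P.det * casoratianF m s A Φ Ψ n t ∧
    casoratianG m s J (fun n t => P *ᵥ Φ n t) (fun n t => P *ᵥ Ψ n t) n t =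
      P.det * casoratianG m s A Φ Ψ n t ∧
    casoratianH m s J (fun n t => P *ᵥ Φ n t) (fun n t => P *ᵥ Ψ n t) n t =
      P.det * casoratianH m s A Φ Ψ n t := by
  have hpow : ∀ (k : ℕ) (v : Fin (2 * m + 2) → ℂ), J ^ k *ᵥ P *ᵥ v = P *ᵥ A ^ k *ᵥ v := by
    intro k v
    have h : J ^ k * P = P * A ^ k :=
      ((show SemiconjBy P A J from hJ.symm).pow_right k).eq.symm
    rw [Matrix.mulVec_mulVec, h, Matrix.mulVec_mulVec]
  unfold casoratianF casoratianG casoratianH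
  simp only [mul_left_comm P.det, ← colDet_mulVec, hpow, apply_ite (P *ᵥ ·), and_self]

theorem theorem1 (m : ℕ) (q r s : ℤ → ℝ → ℂ)
    (hqr : ∀ (n : ℤ) (t : ℝ), SolvesCoupledAt q r n t)
    (hα : ∀ (n : ℤ) (t : ℝ), 1 - q n t * r n t ≠ 0)
    (hs : ∀ (n : ℤ) (t : ℝ), s n t ^ 2 = 1 - q n t * r n t)
    (A : Matrix (Fin (2 * m + 2)) (Fin (2 * m + 2)) ℂ) (hA : A.det ≠ 0)
    (Φ Ψ : ℤ → ℝ → Fin (2 * m + 2) → ℂ) (hΦΨ : SolvesLax q r s A Φ Ψ) :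
    (∀ (n : ℤ) (t : ℝ),
      SolvesBilinearAt q r (casoratianF m s A Φ Ψ) (casoratianG m s A Φ Ψ)
        (casoratianH m s A Φ Ψ) n t) ∧
    (∀ (n : ℤ) (t : ℝ),
      casoratianF m s A Φ Ψ (n - 1) t ≠ 0 → casoratianF m s A Φ Ψ n t ≠ 0 →
      casoratianF m s A Φ Ψ (n + 1) t ≠ 0 →
      SolvesCoupledAt (casoratianQ m s A Φ Ψ) (casoratianR m s A Φ Ψ) n t) ∧
    (∀ P J : Matrix (Fin (2 * m + 2)) (Fin (2 * m + 2)) ℂ, P.det ≠ 0 → A = P⁻¹ * J * P →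
      J.det ≠ 0 ∧
      SolvesLax q r s J (fun n t => P *ᵥ Φ n t) (fun n t => P *ᵥ Ψ n t) ∧
      ∀ (n : ℤ) (t : ℝ),
        (casoratianF m s J (fun n t => P *ᵥ Φ n t) (fun n t => P *ᵥ Ψ n t) n t = 0 ↔
          casoratianF m s A Φ Ψ n t = 0) ∧
        casoratianQ m s J (fun n t => P *ᵥ Φ n t) (fun n t => P *ᵥ Ψ n t) n t =
          casoratianQ m s A Φ Ψ n t ∧
        casoratianR m s J (fun n t => P *ᵥ Φ n t) (fun n t => P *ᵥ Ψ n t) n t =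
          casoratianR m s A Φ Ψ n t) := by
  refine ⟨fun n t => solvesBilinearAt hα hs hA hΦΨ n t (hqr n t), fun n t h₀ h₁ h₂ =>
    (solvesBilinearAt hα hs hA hΦΨ n t (hqr n t)).solvesCoupledAt h₀ h₁ h₂, ?_⟩
  intro P J hP hAJ
  have hP' := isUnit_iff_ne_zero.2 hP
  have hJdet : J.det ≠ 0 := by
    intro h0
    apply hA
    rw [hAJ, Matrix.det_mul, Matrix.det_mul, h0]
    ring
  have hJ : J * P = P * A := by
    rw [hAJ, ← Matrix.mul_assoc, ← Matrix.mul_assoc, Matrix.mul_nonsing_inv P hP', Matrix.one_mul]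
  have hJ' : J⁻¹ * P = P * A⁻¹ := by
    rw [hAJ, Matrix.mul_inv_rev, Matrix.mul_inv_rev, Matrix.nonsing_inv_nonsing_inv P hP',
      ← Matrix.mul_assoc, Matrix.mul_nonsing_inv P hP', Matrix.one_mul]
  refine ⟨hJdet, hΦΨ.conj hJ hJ', fun n t => ?_⟩
  obtain ⟨hF, hG, hH⟩ := casoratian_conj (s := s) hJ Φ Ψ n t
  refine ⟨by rw [hF, mul_eq_zero, or_iff_right hP], ?_, ?_⟩
  · rw [casoratianQ, hG, hF, mul_div_mul_left _ _ hP]; rfl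
  · rw [casoratianR, hH, hF, mul_div_mul_left _ _ hP]; rfl
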